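/- All homology and cohomology is taken with coefficients in the field $\mathbb{F}_2$. For a discrete group $G$, $H_*(G)$ and $H^*(G)$ denote its (co)homology, i.e. that of a $K(G,1)$ space, with the cup product. A group $G$ is said to satisfy property (A) if for every non-zero $\alpha\in H^1(G)$ there is $\beta\in H^1(G)$ such that $\alpha\cup\beta\neq 0$ in $H^2(G)$. Put $\chi_{\le 2}(G):=\dim H_2(G)-\dim H_1(G)+\dim H_0(G)$ (unreduced, so $\dim H_0(G)=1$). Let $G$ and $T$ be finitely presentable groups such that $G$ satisfies property (A), and let $K$ be a finite connected simplicial complex of dimension at most $2$ whose fundamental group is isomorphic to the free product $G * T$. Then $H_1(G)$ and $H_2(G)$ are finite dimensional, and there is a finite connected non-empty simplicial complex $L$ of dimension at most $2$ such that: 1. $L$ has no more $2$-simplices than $K$; 2. $\chi(L)\le\chi_{\le 2}(G)$; 3. $\dim H_2(L)=\dim H_2(G)$; 4. every edge of $L$ is a face of at least two $2$-simplices of $L$. -/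

import Mathlib

open CategoryTheory

universe u

noncomputable section

/-! ### Finite abstract simplicial complexes -/

namespace AbstractSimplicialComplex

/-- The geometric realization of a simplicial complex on a finite vertex set `V`: the points of the
standard simplex of `V` (barycentric coordinates) whose support lies in a face, with the
topology induced from `V → ℝ`. -/
abbrev Realization {V : Type u} [Fintype V] (K : AbstractSimplicialComplex V) : Type u :=
  {x : V → ℝ // x ∈ stdSimplex ℝ V ∧ ∃ s ∈ K.faces, ∀ v, x v ≠ 0 → v ∈ s}

/-- The complex has dimension at most `d`. -/
def DimLE {V : Type*} (K : AbstractSimplicialComplex V) (d : ℕ) : Prop :=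
  ∀ s ∈ K.faces, s.card ≤ d + 1

/-- The set of `n`-simplices. -/
def simplices {V : Type*} (K : AbstractSimplicialComplex V) (n : ℕ) : Set (Finset V) :=
  {s | s ∈ K.faces ∧ s.card = n + 1}

/-- The number of `n`-simplices (of a finite complex). -/
def numSimplices {V : Type*} (K : AbstractSimplicialComplex V) (n : ℕ) : ℕ :=
  (K.simplices n).ncard

/-- The Euler characteristic of a finite complex: the alternating sum of the numbers of simplices.
-/
def eulerChar {V : Type*} [Fintype V] (K : AbstractSimplicialComplex V) : ℤ :=
  ∑ n ∈ Finset.range (Fintype.card V), (-1) ^ n * (K.numSimplices n : ℤ)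

/-- Every edge is a face of at least two 2-simplices. -/
def EdgesInTwoTriangles {V : Type*} (K : AbstractSimplicialComplex V) : Prop :=
  ∀ e ∈ K.simplices 1, 2 ≤ {t | t ∈ K.simplices 2 ∧ e ⊆ t}.ncard

/-! ### Simplicial homology with coefficients in the field with two elements -/

/-- The simplicial `n`-chains with coefficients in `ZMod 2`. -/
abbrev Chain {V : Type u} (K : AbstractSimplicialComplex V) (n : ℕ) : Type u :=
  K.simplices n →₀ ZMod 2

open Classical in
theorem erase_mem_simplices {V : Type*} (K : AbstractSimplicialComplex V) (n : ℕ)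
    (s : K.simplices (n + 1)) (v : V) (hv : v ∈ s.1) : s.1.erase v ∈ K.simplices n := by
  have hc : (s.1.erase v).card = n + 1 := by
    rw [Finset.card_erase_of_mem hv, s.2.2]; rfl
  refine ⟨(K.isRelLowerSet_faces s.2.1).2 (Finset.erase_subset _ _) ?_, hc⟩
  exact Finset.card_pos.1 (by omega)

open Classical in
/-- The simplicial boundary (no signs are needed modulo 2): a simplex is sent to the sum of its
codimension one faces. -/
def boundary {V : Type*} (K : AbstractSimplicialComplex V) (n : ℕ) :
    K.Chain (n + 1) →ₗ[ZMod 2] K.Chain n :=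
  Finsupp.linearCombination (ZMod 2) fun s : K.simplices (n + 1) =>
    ∑ v : {v // v ∈ s.1}, Finsupp.single ⟨s.1.erase v.1, K.erase_mem_simplices n s v.1 v.2⟩ 1

/-- The simplicial `n`-cycles. -/
def cycles {V : Type*} (K : AbstractSimplicialComplex V) :
    (n : ℕ) → Submodule (ZMod 2) (K.Chain n)
  | 0 => ⊤
  | n + 1 => LinearMap.ker (K.boundary n)

/-- The simplicial `n`-boundaries, as a subspace of the `n`-cycles. -/
def boundaries {V : Type*} (K : AbstractSimplicialComplex V) (n : ℕ) :
    Submodule (ZMod 2) (K.cycles n) :=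
  (LinearMap.range (K.boundary n)).comap (K.cycles n).subtype

/-- The simplicial homology `H_n(K; ZMod 2)`, cycles modulo boundaries. -/
abbrev Homology {V : Type u} (K : AbstractSimplicialComplex V) (n : ℕ) : Type u :=
  K.cycles n ⧸ K.boundaries n

end AbstractSimplicialComplex

/-! ### Group homology and cohomology with coefficients in the field with two elements -/

namespace GroupMod2

/-- The trivial coefficient module `ZMod 2`. -/
abbrev coeff (G : Type) [Group G] : Rep (ZMod 2) G := Rep.trivial (ZMod 2) G (ZMod 2)

/-- The homology `H_n(G; ZMod 2)` of the discrete group `G`. -/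
abbrev H_ (n : ℕ) (G : Type) [Group G] : ModuleCat (ZMod 2) := groupHomology (coeff G) n

/-- The 2-truncated Euler characteristic `dim H_2(G) - dim H_1(G) + dim H_0(G)`. -/
def truncEulerChar (G : Type) [Group G] : ℤ :=
  (Module.finrank (ZMod 2) (H_ 2 G) : ℤ) - Module.finrank (ZMod 2) (H_ 1 G)
    + Module.finrank (ZMod 2) (H_ 0 G)

/-- The homomorphism `G → ZMod 2` (inhomogeneous 1-cocycle) representing a class in
`H^1(G; ZMod 2)`; it is unique because the coefficients are trivial. -/
def toHom {G : Type} [Group G] (a : groupCohomology (coeff G) 1) : Additive G →+ ZMod 2 :=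
  (groupCohomology.H1IsoOfIsTrivial (coeff G)).hom a

/-- The cup product of two inhomogeneous 1-cocycles: `(g, h) ↦ α(g) β(h)`. -/
def cupCocycle {G : Type} [Group G] (α β : Additive G →+ ZMod 2) :
    groupCohomology.cocycles₂ (coeff G) :=
  ⟨fun p => α (Additive.ofMul p.1) * β (Additive.ofMul p.2), by
    rw [groupCohomology.mem_cocycles₂_def]
    intro g h j
    simp only [ofMul_mul, map_add, Representation.isTrivial_def, LinearMap.id_apply]
    ring⟩

/-- The cup product `H^1(G; ZMod 2) × H^1(G; ZMod 2) → H^2(G; ZMod 2)`. -/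
def cup {G : Type} [Group G] (a b : groupCohomology (coeff G) 1) : groupCohomology (coeff G) 2 :=
  groupCohomology.H2π (coeff G) (cupCocycle (toHom a) (toHom b))

/-- Property (A): for every nonzero `a` in `H^1(G)` there is `b` in `H^1(G)` such that the cup
product of `a` and `b` is nonzero in `H^2(G)`. -/
def PropertyA (G : Type) [Group G] : Prop :=
  ∀ a : groupCohomology (coeff G) 1, a ≠ 0 →
    ∃ b : groupCohomology (coeff G) 1, cup a b ≠ 0

end GroupMod2

end

/-! The retraction of `G * T` onto `G` turns π₁(K) into a group that retracts onto `G`. Labelling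
the edges of `K` by elements of `G` sends each ordered triangle to a bar 2-simplex, and hence
2-cycles of `K` to `H_ 2 G`. This map is onto. By duality it is enough that a 2-cocycle `c` of `G`
which becomes a coboundary on `K` is a coboundary: in that case the labels lift to the central
extension of `G` defined by `c`, the lifted labels give a homomorphism from π₁(K)
(`exists_isEdgeCocycle`), and restricting it to `G` splits the extension
(`isTwoCoboundary_of_edge`).

Now take a minimal family `S` of triangles of `K` whose cycles still surject onto `H_ 2 G`
(`exists_minimal_family`). Minimality makes the surjection an isomorphism and puts every triangle of
`S` in the support of a cycle, so each edge of `S` lies in two triangles.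

Property (A) makes H¹(G) inject into H¹ of the complex spanned by `S`: if α is a coboundary on `S`,
so is every α ∪ β, which therefore vanishes on all of `H_ 2 G` and so in H²(G), forcing α = 0
(`hom_eq_zero_of_coboundary`). Comparing dimensions of 1-cocycles and 2-cycles of `S` gives the
bound on the Euler characteristic (`finite_and_finrank_le`). Finally `L` is the wedge of the
components of `S`, which joins them without changing edges, triangles or 2-cycles. -/

noncomputable section

/-! ### Paths in the realization and their reduction to edge paths. -/

namespace AbstractSimplicialComplex

open Set Topology
open scoped unitInterval

variable {V : Type u} [Fintype V] (K : AbstractSimplicialComplex V)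

/-- The subset of `V → ℝ` underlying the geometric realization. -/
def realizationSet : Set (V → ℝ) :=
  {x | x ∈ stdSimplex ℝ V ∧ ∃ s ∈ K.faces, ∀ v, x v ≠ 0 → v ∈ s}

theorem exists_ne_zero (x : K.Realization) : ∃ v, x.1 v ≠ 0 := by
  by_contra! h
  have := x.2.1.2
  simp [h] at this

/-- A star-convex set is contractible, hence simply connected; the homotopy found inside it is
pushed into the realization. -/
theorem homotopic_of_starConvex {S : Set (V → ℝ)} {c : V → ℝ} (hS : StarConvex ℝ c S)
    (hSK : S ⊆ K.realizationSet) {x y : K.Realization} (γ γ' : Path x y)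
    (h : ∀ t, (γ t).1 ∈ S) (h' : ∀ t, (γ' t).1 ∈ S) : γ.Homotopic γ' := by
  have hx : x.1 ∈ S := by simpa using h 0
  have hy : y.1 ∈ S := by simpa using h 1
  have : ContractibleSpace S := hS.contractibleSpace ⟨_, hx⟩
  let f : C(S, K.Realization) := ⟨fun z => ⟨z.1, hSK z.2⟩, by fun_prop⟩
  let lift (δ : Path x y) (hδ : ∀ t, (δ t).1 ∈ S) : Path (⟨x.1, hx⟩ : S) ⟨y.1, hy⟩ :=
    { toFun := fun t => ⟨(δ t).1, hδ t⟩
      continuous_toFun := by fun_prop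
      source' := by simp
      target' := by simp }
  exact (SimplyConnectedSpace.paths_homotopic (lift γ h) (lift γ' h')).map f

/-- The points of the realization whose support lies in `s`. -/
def cell (s : Finset V) : Set (V → ℝ) := {x | x ∈ stdSimplex ℝ V ∧ ∀ v, x v ≠ 0 → v ∈ s}

theorem cell_subset {s : Finset V} (hs : s ∈ K.faces) : cell s ⊆ K.realizationSet :=
  fun _ hx => ⟨hx.1, s, hs, hx.2⟩

theorem convex_cell (s : Finset V) : Convex ℝ (cell s) := by
  intro x hx y hy a b ha hb hab
  refine ⟨convex_stdSimplex ℝ V hx.1 hy.1 ha hb hab, fun v hv => ?_⟩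
  by_contra hvs
  have h1 : x v = 0 := by_contra fun h => hvs (hx.2 v h)
  have h2 : y v = 0 := by_contra fun h => hvs (hy.2 v h)
  simp [h1, h2] at hv

open Classical in
/-- The vertex `v` as a point of the realization. -/
def vertex (v : V) : K.Realization :=
  ⟨Pi.single v 1, single_mem_stdSimplex ℝ v, {v}, K.singleton_mem v, fun w hw => by
    by_contra h
    simp only [Finset.mem_singleton] at h
    exact hw (Pi.single_eq_of_ne h _)⟩

theorem vertex_apply_self (v : V) : (K.vertex v).1 v = 1 := by simp [vertex]

theorem eq_of_vertex_apply_ne_zero {v w : V} (h : (K.vertex v).1 w ≠ 0) : w = v := by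
  by_contra h'
  exact h (by simp [vertex, h'])

/-- The open star of `v`, as a subset of `V → ℝ`. -/
def starSet (v : V) : Set (V → ℝ) := {x | x ∈ K.realizationSet ∧ x v ≠ 0}

theorem lineMap_vertex_support (x : K.Realization) (v w : V) {a b : ℝ}
    (hw : (a • (K.vertex v).1 + b • x.1) w ≠ 0) : w = v ∨ x.1 w ≠ 0 := by
  by_contra! h
  have h0 : (K.vertex v).1 w = 0 := by_contra fun h' => h.1 (K.eq_of_vertex_apply_ne_zero h')
  simp [h.2, h0] at hw

/-- A face containing the support of `x` already contains `v`, so the segment to `v` stays in that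
face, and the coordinate at `v` stays positive along it. -/
theorem starConvex_starSet (v : V) : StarConvex ℝ (K.vertex v).1 (K.starSet v) := by
  rintro x ⟨hx, hxv⟩ a b ha hb hab
  have hx0 : 0 ≤ x v := hx.1.1 v
  refine ⟨⟨convex_stdSimplex ℝ V (K.vertex v).2.1 hx.1 ha hb hab, ?_⟩, ?_⟩
  · obtain ⟨s, hs, h⟩ := hx.2
    refine ⟨s, hs, fun w hw => ?_⟩
    rcases K.lineMap_vertex_support ⟨x, hx⟩ v w hw with rfl | h'
    · exact h _ hxv
    · exact h _ h'
  · have h1 := K.vertex_apply_self v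
    have : 0 < x v := lt_of_le_of_ne hx0 (Ne.symm hxv)
    simp only [Pi.add_apply, Pi.smul_apply, smul_eq_mul, h1]
    rcases ha.eq_or_lt with rfl | ha'
    · have : b = 1 := by linarith
      subst this
      simpa using hxv
    · positivity

theorem starSet_subset (v : V) : K.starSet v ⊆ K.realizationSet := fun _ h => h.1

/-- The straight path from a point to a vertex with which it shares a face. -/
def toVertex (x : K.Realization) (v : V)
    (h : ∃ s ∈ K.faces, v ∈ s ∧ ∀ w, x.1 w ≠ 0 → w ∈ s) : Path x (K.vertex v) where
  toFun t := ⟨(t : ℝ) • (K.vertex v).1 + (1 - (t : ℝ)) • x.1,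
    convex_stdSimplex ℝ V (K.vertex v).2.1 x.2.1 t.2.1 (by linarith [t.2.2]) (by ring), by
      obtain ⟨s, hs, hv, h⟩ := h
      refine ⟨s, hs, fun w hw => ?_⟩
      rcases K.lineMap_vertex_support x v w hw with rfl | h'
      exacts [hv, h _ h']⟩
  continuous_toFun := by fun_prop
  source' := by simp
  target' := by simp

theorem toVertex_mem_starSet (x : K.Realization) (v : V) (h) (hx : x.1 v ≠ 0) (t : I) :
    (K.toVertex x v h t).1 ∈ K.starSet v :=
  K.starConvex_starSet v ⟨x.2, hx⟩ t.2.1 (by linarith [t.2.2]) (by ring)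

theorem toVertex_support (x : K.Realization) (v w : V) (h) (t : I)
    (hw : (K.toVertex x v h t).1 w ≠ 0) : w = v ∨ x.1 w ≠ 0 :=
  K.lineMap_vertex_support x v w hw

theorem toVertex_mem_cell (x : K.Realization) (v : V) (h) {s : Finset V} (hv : v ∈ s)
    (hs : ∀ w, x.1 w ≠ 0 → w ∈ s) (t : I) : (K.toVertex x v h t).1 ∈ cell s := by
  refine ⟨(K.toVertex x v h t).2.1, fun w hw => ?_⟩
  rcases K.toVertex_support x v w h t hw with rfl | h'
  exacts [hv, hs w h']

theorem isOpen_star (v : V) : IsOpen {x : K.Realization | x.1 v ≠ 0} :=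
  isOpen_ne_fun ((continuous_apply v).comp continuous_subtype_val) continuous_const

theorem exists_face_of_ne_zero {x : K.Realization} {v : V} (h : x.1 v ≠ 0) :
    ∃ s ∈ K.faces, v ∈ s ∧ ∀ w, x.1 w ≠ 0 → w ∈ s :=
  let ⟨s, hs, hx⟩ := x.2.2
  ⟨s, hs, hx _ h, hx⟩

theorem exists_face_of_adj {u v : V} (h : ∃ s ∈ K.faces, u ∈ s ∧ v ∈ s) :
    ∃ s ∈ K.faces, v ∈ s ∧ ∀ w, (K.vertex u).1 w ≠ 0 → w ∈ s :=
  let ⟨s, hs, hu, hv⟩ := h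
  ⟨s, hs, hv, fun _ hw => K.eq_of_vertex_apply_ne_zero hw ▸ hu⟩

/-- The homotopy class of the edge from `u` to `v`. -/
def edge (u v : V) (h : ∃ s ∈ K.faces, u ∈ s ∧ v ∈ s) :
    Path.Homotopic.Quotient (K.vertex u) (K.vertex v) :=
  .mk (K.toVertex (K.vertex u) v (K.exists_face_of_adj h))

theorem trans_mem {X : Type*} [TopologicalSpace X] {x y z : X} (γ : Path x y) (γ' : Path y z)
    {p : X → Prop} (h : ∀ t, p (γ t)) (h' : ∀ t, p (γ' t)) (t : I) : p (γ.trans γ' t) := by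
  have : γ.trans γ' t ∈ range (γ.trans γ') := mem_range_self t
  rw [Path.trans_range] at this
  rcases this with ⟨t, ht⟩ | ⟨t, ht⟩
  · exact ht ▸ h t
  · exact ht ▸ h' t

theorem toVertex_trans_edge (x : K.Realization) {u v : V} {s : Finset V} (hs : s ∈ K.faces)
    (hu : u ∈ s) (hv : v ∈ s) (hx : ∀ w, x.1 w ≠ 0 → w ∈ s) :
    (Path.Homotopic.Quotient.mk (K.toVertex x u ⟨s, hs, hu, hx⟩)).trans
      (K.edge u v ⟨s, hs, hu, hv⟩) = .mk (K.toVertex x v ⟨s, hs, hv, hx⟩) := by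
  rw [edge, ← Path.Homotopic.Quotient.mk_trans, Path.Homotopic.Quotient.eq]
  refine K.homotopic_of_starConvex ((convex_cell s).starConvex (K.toVertex_mem_cell x u
    ⟨s, hs, hu, hx⟩ hu hx 0)) (K.cell_subset hs) _ _ (fun t => ?_) (fun t => ?_)
  · refine trans_mem (p := fun z : K.Realization => z.1 ∈ cell s) _ _ (fun t => ?_) (fun t => ?_) t
    · exact K.toVertex_mem_cell x u _ hu hx t
    · exact K.toVertex_mem_cell _ v _ hv
        (fun w hw => (K.eq_of_vertex_apply_ne_zero hw) ▸ hu) t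
  · exact K.toVertex_mem_cell x v _ hv hx t

theorem edge_trans_edge {u v w : V} {s : Finset V} (hs : s ∈ K.faces)
    (hu : u ∈ s) (hv : v ∈ s) (hw : w ∈ s) :
    (K.edge u v ⟨s, hs, hu, hv⟩).trans (K.edge v w ⟨s, hs, hv, hw⟩) =
      K.edge u w ⟨s, hs, hu, hw⟩ :=
  K.toVertex_trans_edge _ hs hv hw fun _ h => K.eq_of_vertex_apply_ne_zero h ▸ hu

theorem toVertex_vertex_self (v : V) (h) :
    Path.Homotopic.Quotient.mk (K.toVertex (K.vertex v) v h) = .refl (K.vertex v) := by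
  rw [← Path.Homotopic.Quotient.mk_refl, Path.Homotopic.Quotient.eq]
  have h0 : (K.vertex v).1 v ≠ 0 := by rw [K.vertex_apply_self]; exact one_ne_zero
  exact K.homotopic_of_starConvex (K.starConvex_starSet v) (K.starSet_subset v) _ _
    (K.toVertex_mem_starSet _ _ _ h0) (fun _ => ⟨(K.vertex v).2, h0⟩)

instance pathConnectedSpace_realization [ConnectedSpace K.Realization] :
    PathConnectedSpace K.Realization := by
  have hstar (x : K.Realization) (v : V) (h : x.1 v ≠ 0) : Joined x (K.vertex v) :=
    ⟨K.toVertex x v (K.exists_face_of_ne_zero h)⟩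
  have hopen (x : K.Realization) : IsOpen (pathComponent x) := by
    rw [isOpen_iff_mem_nhds]
    intro y hy
    obtain ⟨v, hv⟩ := K.exists_ne_zero y
    filter_upwards [(K.isOpen_star v).mem_nhds hv] with z hz
    exact (Joined.trans hy (hstar y v hv)).trans (hstar z v hz).symm
  have hclopen (x : K.Realization) : IsClopen (pathComponent x) := by
    refine ⟨⟨?_⟩, hopen x⟩
    rw [isOpen_iff_mem_nhds]
    intro y hy
    filter_upwards [(hopen y).mem_nhds (mem_pathComponent_self y)] with z hz hz'
    exact hy (Joined.trans hz' (Joined.symm hz))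
  have x₀ : K.Realization := Classical.arbitrary _
  refine ⟨⟨x₀⟩, fun x y => ?_⟩
  have := (hclopen x).eq_univ ⟨x, mem_pathComponent_self x⟩
  exact (this ▸ mem_univ y : y ∈ pathComponent x)

/-- A group-valued function on the oriented edges that is multiplicative on triangles. -/
def IsEdgeCocycle {V : Type*} (K : AbstractSimplicialComplex V) {E : Type*} [Group E]
    (e : V → V → E) : Prop :=
  ∀ s ∈ K.faces, ∀ u ∈ s, ∀ v ∈ s, ∀ w ∈ s, e u v * e v w = e u w

/-- `EdgeWalk e P y`: the path class `P` is a product of edges, along which the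
product of the values of `e` is `y`. -/
inductive EdgeWalk {E : Type*} [Group E] (e : V → V → E) (u : V) :
    (v : V) → Path.Homotopic.Quotient (K.vertex u) (K.vertex v) → E → Prop
  | refl : EdgeWalk e u u (.refl _) 1
  | step {v w : V} {P : Path.Homotopic.Quotient (K.vertex u) (K.vertex v)} {y : E}
      (h : ∃ s ∈ K.faces, v ∈ s ∧ w ∈ s) :
      EdgeWalk e u v P y → EdgeWalk e u w (P.trans (K.edge v w h)) (y * e v w)

variable {K}

theorem EdgeWalk.trans {E : Type*} [Group E] {e : V → V → E} {u v w : V}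
    {P : Path.Homotopic.Quotient (K.vertex u) (K.vertex v)}
    {Q : Path.Homotopic.Quotient (K.vertex v) (K.vertex w)} {y z : E}
    (hP : K.EdgeWalk e u v P y) (hQ : K.EdgeWalk e v w Q z) :
    K.EdgeWalk e u w (P.trans Q) (y * z) := by
  induction hQ with
  | refl => simpa using hP
  | step h _ ih => simpa [mul_assoc] using EdgeWalk.step h ih

/-- Simplicial approximation of a path: by compactness it is cut into finitely many pieces, each
inside an open star, and the centres of successive stars share a face. -/
theorem exists_edgeWalk {E : Type*} [Group E] (e : V → V → E) {u w : V}
    (P : Path.Homotopic.Quotient (K.vertex u) (K.vertex w)) : ∃ y, K.EdgeWalk e u w P y := by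
  obtain ⟨γ, rfl⟩ := P.mk_surjective
  obtain ⟨t, ht0, htm, ⟨m, hm⟩, hc⟩ := exists_monotone_Icc_subset_open_cover_unitInterval
    (c := fun v : V => γ ⁻¹' {x : K.Realization | x.1 v ≠ 0})
    (fun v => (K.isOpen_star v).preimage γ.continuous)
    (fun s _ => by
      obtain ⟨v, hv⟩ := K.exists_ne_zero (γ s)
      exact mem_iUnion.2 ⟨v, hv⟩)
  choose v hv using hc
  have hl (i : ℕ) : (γ (t i)).1 (v i) ≠ 0 := hv i ⟨le_rfl, htm (Nat.le_succ i)⟩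
  have hr (i : ℕ) : (γ (t (i + 1))).1 (v i) ≠ 0 := hv i ⟨htm (Nat.le_succ i), le_rfl⟩
  -- The path up to time `t i`, closed up by straight segments to `v 0` and `v i`. One more piece
  -- adds one edge: the piece and both segments to `v i` lie in the star of `v i`, and `v i`, `v (i
  -- + 1)` span a face with the point `γ (t (i + 1))`.
  have key (i : ℕ) : ∃ y, K.EdgeWalk e (v 0) (v i)
      (((Path.Homotopic.Quotient.mk
          (K.toVertex (γ (t 0)) (v 0) (K.exists_face_of_ne_zero (hl 0)))).symm.trans
        (.mk (γ.subpath (t 0) (t i)))).trans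
        (.mk (K.toVertex (γ (t i)) (v i) (K.exists_face_of_ne_zero (hl i))))) y := by
    induction i with
    | zero =>
      refine ⟨1, ?_⟩
      convert EdgeWalk.refl
      simp
    | succ i ih =>
      obtain ⟨y, hy⟩ := ih
      obtain ⟨s, hs, hx⟩ := (γ (t (i + 1))).2.2
      refine ⟨y * e (v i) (v (i + 1)), ?_⟩
      convert EdgeWalk.step ⟨s, hs, hx _ (hr i), hx _ (hl (i + 1))⟩ hy using 1
      have h1 := K.toVertex_trans_edge _ hs (hx _ (hr i)) (hx _ (hl (i + 1))) hx
      have h2 : Path.Homotopic.Quotient.mk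
          (K.toVertex (γ (t i)) (v i) (K.exists_face_of_ne_zero (hl i))) =
          (Path.Homotopic.Quotient.mk (γ.subpath (t i) (t (i + 1)))).trans
            (.mk (K.toVertex _ (v i) (K.exists_face_of_ne_zero (hr i)))) := by
        rw [← Path.Homotopic.Quotient.mk_trans, Path.Homotopic.Quotient.eq]
        refine K.homotopic_of_starConvex (K.starConvex_starSet (v i)) (K.starSet_subset _) _ _
          (K.toVertex_mem_starSet _ _ _ (hl i)) (trans_mem (p := fun z : K.Realization => z.1 ∈ K.starSet (v i))
            _ _ (fun τ => ⟨(γ.subpath _ _ τ).2, ?_⟩) (K.toVertex_mem_starSet _ _ _ (hr i)))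
        have : γ.subpath (t i) (t (i + 1)) τ ∈ range (γ.subpath (t i) (t (i + 1))) :=
          mem_range_self τ
        rw [Path.range_subpath_of_le _ _ _ (htm (Nat.le_succ i))] at this
        obtain ⟨r, hr₁, hr₂⟩ := this
        rw [← hr₂]
        exact hv i hr₁
      have h3 : (Path.Homotopic.Quotient.mk (γ.subpath (t 0) (t (i + 1)))) =
          (Path.Homotopic.Quotient.mk (γ.subpath (t 0) (t i))).trans
            (.mk (γ.subpath (t i) (t (i + 1)))) := by
        rw [← Path.Homotopic.Quotient.mk_trans, Path.Homotopic.Quotient.eq]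
        exact ⟨(Path.Homotopy.subpathTransSubpath γ _ _ _).symm⟩
      rw [h2, h3, ← h1]
      simp
  -- The ends of the subpath equal the two vertices only propositionally; variable end points allow
  -- the equalities to be substituted.
  have aux {a b : K.Realization} (ha : a = K.vertex u) (hb : b = K.vertex w) (δ : Path a b)
      (hδ : δ = γ.cast ha hb) (hu hw) :
      ((Path.Homotopic.Quotient.mk (K.toVertex a u hu)).symm.trans (.mk δ)).trans
        (.mk (K.toVertex b w hw)) = .mk γ := by
    subst ha hb hδ
    rw [toVertex_vertex_self, toVertex_vertex_self, ← Path.Homotopic.Quotient.mk_refl,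
      ← Path.Homotopic.Quotient.mk_symm, Path.refl_symm]
    simp
  obtain ⟨y, hy⟩ := key m
  have h0 := hl 0
  have h1 := hl m
  have e0 : γ (t 0) = K.vertex u := by rw [ht0, γ.source]
  have e1 : γ (t m) = K.vertex w := by rw [hm m le_rfl, γ.target]
  rw [e0] at h0
  rw [e1] at h1
  have hu := K.eq_of_vertex_apply_ne_zero h0
  have hw := K.eq_of_vertex_apply_ne_zero h1
  subst hu hw
  refine ⟨y, ?_⟩
  rw [← aux e0 e1 (γ.subpath (t 0) (t m)) ?_]
  · exact hy
  · ext s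
    simp [Path.subpath, ht0, hm m le_rfl]

end AbstractSimplicialComplex

/-! ### The covering defined by an edge cocycle, and its monodromy. -/

namespace AbstractSimplicialComplex

open Set Topology
open scoped unitInterval

variable {V : Type u} [Fintype V] {K : AbstractSimplicialComplex V}

theorem IsEdgeCocycle.apply_self {V : Type*} {K : AbstractSimplicialComplex V} {E : Type*} [Group E] {e : V → V → E} (he : K.IsEdgeCocycle e)
    (v : V) : e v v = 1 := by
  simpa using he {v} (K.singleton_mem v) v (by simp) v (by simp) v (by simp)

/-- The principal bundle, with discrete fibre, glued from an edge cocycle. -/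
def IsEdgeCocycle.bundle {E : Type*} [Group E] [TopologicalSpace E] [DiscreteTopology E]
    {e : V → V → E} (he : K.IsEdgeCocycle e) : FiberBundleCore V K.Realization E where
  baseSet v := {x | x.1 v ≠ 0}
  isOpen_baseSet := K.isOpen_star
  indexAt x := (K.exists_ne_zero x).choose
  mem_baseSet_at x := (K.exists_ne_zero x).choose_spec
  coordChange i j _ f := f * e i j
  coordChange_self i x hx v := by simp [he.apply_self]
  continuousOn_coordChange i j :=
    ((continuous_of_discreteTopology (f := fun f : E => f * e i j)).comp
      continuous_snd).continuousOn
  coordChange_comp i j k x hx v := by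
    obtain ⟨s, hs, h⟩ := x.2.2
    rw [mul_assoc, he s hs _ (h _ hx.1.1) _ (h _ hx.1.2) _ (h _ hx.2)]

/-- The lift has constant coordinate `f` relative to `u`; `f * e u _` is that coordinate in the
preferred chart at each point. Points need only share a face with `u`, so the path may end outside
the open star of `u`. -/
theorem IsEdgeCocycle.monodromy {E : Type*} [Group E] [TopologicalSpace E] [DiscreteTopology E]
    {e : V → V → E} (he : K.IsEdgeCocycle e) (u : V) {x y : K.Realization} (γ : Path x y)
    (hγ : ∀ t, ∃ s ∈ K.faces, u ∈ s ∧ ∀ w, (γ t).1 w ≠ 0 → w ∈ s) (f : E) :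
    (FiberBundle.isCoveringMap (F := E) (E := he.bundle.Fiber)).monodromy (.mk γ)
      ⟨⟨x, f * e u (he.bundle.indexAt x)⟩, rfl⟩ = ⟨⟨y, f * e u (he.bundle.indexAt y)⟩, rfl⟩ := by
  let Γ : C(I, he.bundle.TotalSpace) := 
    { toFun := fun t => ⟨γ t, f * e u (he.bundle.indexAt (γ t))⟩
      continuous_toFun := by
        rw [continuous_iff_continuousAt]
        intro t
        rw [FiberBundle.continuousAt_totalSpace]
        refine ⟨γ.continuous.continuousAt, ?_⟩
        have hmem := he.bundle.mem_baseSet_at (γ t)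
        have : ∀ᶠ t' in 𝓝 t, (f * e u (he.bundle.indexAt (γ t'))) *
            e (he.bundle.indexAt (γ t')) (he.bundle.indexAt (γ t)) =
              f * e u (he.bundle.indexAt (γ t)) := by
          filter_upwards [γ.continuous.continuousAt
            ((he.bundle.isOpen_baseSet _).mem_nhds hmem)] with t' ht'
          obtain ⟨s, hs, hu, h⟩ := hγ t'
          rw [mul_assoc, he s hs _ hu _ (h _ (he.bundle.mem_baseSet_at (γ t'))) _ (h _ ht')]
        exact (continuousAt_const (y := f * e u (he.bundle.indexAt (γ t)))).congr
          (this.mono fun _ h => h.symm) }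
  have h0 : (γ : C(I, K.Realization)) 0 =
      (⟨x, f * e u (he.bundle.indexAt x)⟩ : he.bundle.TotalSpace).proj := γ.source
  have hΓ : Γ = (FiberBundle.isCoveringMap (F := E) (E := he.bundle.Fiber)).liftPath γ
      ⟨x, f * e u (he.bundle.indexAt x)⟩ h0 := by
    rw [IsCoveringMap.eq_liftPath_iff']
    have key (z : K.Realization) (hz : z = x) :
        (⟨z, f * e u (he.bundle.indexAt z)⟩ : he.bundle.TotalSpace) =
          ⟨x, f * e u (he.bundle.indexAt x)⟩ := by rw [hz]
    exact ⟨rfl, key _ γ.source⟩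
  refine Subtype.ext ?_
  refine (congrArg (fun δ : C(I, he.bundle.TotalSpace) => δ 1) hΓ.symm).trans ?_
  have key (z : K.Realization) (hz : z = y) :
      (⟨z, f * e u (he.bundle.indexAt z)⟩ : he.bundle.TotalSpace) =
        ⟨y, f * e u (he.bundle.indexAt y)⟩ := by rw [hz]
  exact key _ γ.target

theorem IsEdgeCocycle.indexAt_vertex {E : Type*} [Group E] [TopologicalSpace E]
    [DiscreteTopology E] {e : V → V → E} (he : K.IsEdgeCocycle e) (v : V) :
    he.bundle.indexAt (K.vertex v) = v :=
  K.eq_of_vertex_apply_ne_zero (he.bundle.mem_baseSet_at (K.vertex v))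

theorem EdgeWalk.monodromy {E : Type*} [Group E] [TopologicalSpace E] [DiscreteTopology E]
    {e : V → V → E} (he : K.IsEdgeCocycle e) {u v : V}
    {P : Path.Homotopic.Quotient (K.vertex u) (K.vertex v)} {y : E} (h : K.EdgeWalk e u v P y) :
    (FiberBundle.isCoveringMap (F := E) (E := he.bundle.Fiber)).monodromy P
      ⟨⟨K.vertex u, (1 : E)⟩, rfl⟩ = ⟨⟨K.vertex v, y⟩, rfl⟩ := by
  induction h with
  | refl => rw [IsCoveringMap.monodromy_refl]; rfl
  | @step v w P y h _ ih =>
    rw [IsCoveringMap.monodromy_trans_apply, ih]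
    have := he.monodromy v (K.toVertex (K.vertex v) w (K.exists_face_of_adj h)) (fun t => by
      obtain ⟨s, hs, hv, hw⟩ := h
      exact ⟨s, hs, hv, (K.toVertex_mem_cell _ w _ hw
        (fun _ h => K.eq_of_vertex_apply_ne_zero h ▸ hv) t).2⟩) y
    rw [he.indexAt_vertex, he.indexAt_vertex, he.apply_self, mul_one] at this
    exact this

/-- Both values are the end point of the lift starting at 1, which depends only on the homotopy
class. -/
theorem EdgeWalk.unique {E : Type*} [Group E] {e : V → V → E} (he : K.IsEdgeCocycle e) {u v : V}
    {P : Path.Homotopic.Quotient (K.vertex u) (K.vertex v)} {y z : E}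
    (h : K.EdgeWalk e u v P y) (h' : K.EdgeWalk e u v P z) : y = z := by
  let _ : TopologicalSpace E := ⊥
  have : DiscreteTopology E := ⟨rfl⟩
  have := congrArg Subtype.val ((h.monodromy he).symm.trans (h'.monodromy he))
  exact eq_of_heq (Bundle.TotalSpace.mk.inj this).2

theorem trans_symm_trans {X : Type*} [TopologicalSpace X] {x y z : X}
    (P : Path.Homotopic.Quotient x y) (Q : Path.Homotopic.Quotient x z) :
    P.trans (P.symm.trans Q) = Q := by
  rw [← Path.Homotopic.Quotient.trans_assoc]
  simp

theorem symm_trans_trans {X : Type*} [TopologicalSpace X] {x y z : X}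
    (P : Path.Homotopic.Quotient x y) (Q : Path.Homotopic.Quotient y z) :
    P.symm.trans (P.trans Q) = Q := by
  rw [← Path.Homotopic.Quotient.trans_assoc]
  simp

/-- A homomorphism from the fundamental group is given by an edge cocycle, and lifts along a group
homomorphism as soon as the edge cocycle does. -/
theorem exists_isEdgeCocycle [ConnectedSpace K.Realization] (x₀ : K.Realization)
    {G : Type*} [Group G] (φ : FundamentalGroup K.Realization x₀ →* G) :
    ∃ g : V → V → G, K.IsEdgeCocycle g ∧
      ∀ {E : Type*} [Group E] (q : E →* G) (e : V → V → E), K.IsEdgeCocycle e →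
        (∀ s ∈ K.faces, ∀ u ∈ s, ∀ v ∈ s, q (e u v) = g u v) →
        ∃ ρ : FundamentalGroup K.Realization x₀ →* E, q.comp ρ = φ := by
  classical
  let p (v : V) : Path.Homotopic.Quotient x₀ (K.vertex v) := .mk (PathConnectedSpace.somePath _ _)
  let φ' (P : Path.Homotopic.Quotient x₀ x₀) : G := φ P
  have hφ' (P Q : Path.Homotopic.Quotient x₀ x₀) : φ' (P.trans Q) = φ' Q * φ' P := map_mul φ _ _
  have hφ'1 : φ' (.refl x₀) = 1 := map_one φ
  -- `φ'` reverses the order of concatenation; the inverse makes `ψ` multiplicative along paths. The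
  -- same inverse reappears in the homomorphism built below.
  let ψ {u v : V} (P : Path.Homotopic.Quotient (K.vertex u) (K.vertex v)) : G :=
    (φ' (((p u).trans P).trans (p v).symm))⁻¹
  have hψ {u v w : V} (P : Path.Homotopic.Quotient (K.vertex u) (K.vertex v))
      (Q : Path.Homotopic.Quotient (K.vertex v) (K.vertex w)) : ψ (P.trans Q) = ψ P * ψ Q := by
    simp only [ψ, ← mul_inv_rev, ← hφ']
    congr 2
    simp [symm_trans_trans]
  have hψ1 (u : V) : ψ (.refl (K.vertex u)) = 1 := by
    have := hψ (.refl (K.vertex u)) (.refl (K.vertex u))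
    simpa using this
  let g (u v : V) : G :=
    if h : ∃ s ∈ K.faces, u ∈ s ∧ v ∈ s then ψ (K.edge u v h) else 1
  have hg {u v : V} (h : ∃ s ∈ K.faces, u ∈ s ∧ v ∈ s) : g u v = ψ (K.edge u v h) := dif_pos h
  refine ⟨g, ?_, ?_⟩
  · intro s hs u hu v hv w hw
    rw [hg ⟨s, hs, hu, hv⟩, hg ⟨s, hs, hv, hw⟩, hg ⟨s, hs, hu, hw⟩, ← hψ,
      K.edge_trans_edge hs hu hv hw]
  · intro E _ q e he hq
    have hwalk {u v : V} {P : Path.Homotopic.Quotient (K.vertex u) (K.vertex v)} {y : E}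
        (h : K.EdgeWalk e u v P y) : q y = ψ P := by
      induction h with
      | refl => rw [hψ1, map_one]
      | step h _ ih =>
        rw [map_mul, ih, hψ, ← hg h]
        obtain ⟨s, hs, hv, hw⟩ := h
        rw [hq s hs _ hv _ hw]
    obtain ⟨v₀, -⟩ := K.exists_ne_zero x₀
    let P (x : Path.Homotopic.Quotient x₀ x₀) := ((p v₀).symm.trans x).trans (p v₀)
    choose r hr using fun x => exists_edgeWalk e (P x)
    refine ⟨⟨⟨fun x : Path.Homotopic.Quotient x₀ x₀ => (r x)⁻¹, ?_⟩,
      fun (x y : Path.Homotopic.Quotient x₀ x₀) => ?_⟩, MonoidHom.ext fun x => ?_⟩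
    · rw [inv_eq_one]
      refine (hr (.refl x₀)).unique he ?_
      convert EdgeWalk.refl
      simp [P]
    · change (r (y.trans x))⁻¹ = (r x)⁻¹ * (r y)⁻¹
      rw [← mul_inv_rev, inv_inj]
      refine (hr (y.trans x)).unique he ?_
      convert (hr y).trans (hr x) using 1
      simp [P, trans_symm_trans]
    · change Path.Homotopic.Quotient x₀ x₀ at x
      change q (r x)⁻¹ = φ' x
      rw [map_inv, hwalk (hr x)]
      simp only [ψ, inv_inv, P]
      congr 1
      simp [trans_symm_trans]

end AbstractSimplicialComplex

/-! ### Edge cocycles determined by increasing triples. -/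

namespace AbstractSimplicialComplex

theorem isEdgeCocycle_of_lt {V : Type*} [LinearOrder V] {K : AbstractSimplicialComplex V}
    {E : Type*} [Group E] {e : V → V → E} (h1 : ∀ v, e v v = 1)
    (hinv : ∀ u v, e v u = (e u v)⁻¹)
    (h : ∀ s ∈ K.faces, ∀ u ∈ s, ∀ v ∈ s, ∀ w ∈ s, u < v → v < w → e u v * e v w = e u w) :
    K.IsEdgeCocycle e := by
  intro s hs u hu v hv w hw
  rcases lt_trichotomy u v with huv | rfl | huv
  · rcases lt_trichotomy v w with hvw | rfl | hvw
    · exact h s hs u hu v hv w hw huv hvw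
    · simp [h1]
    · rcases lt_trichotomy u w with huw | rfl | huw
      · rw [← h s hs u hu w hw v hv huw hvw, hinv w v]; simp
      · rw [hinv u v, h1]; simp
      · rw [hinv w v, hinv w u, ← h s hs w hw u hu v hv huw huv]; simp
  · simp [h1]
  · rcases lt_trichotomy v w with hvw | rfl | hvw
    · rcases lt_trichotomy u w with huw | rfl | huw
      · rw [← h s hs v hv u hu w hw huv huw, hinv v u]; simp
      · rw [hinv v u, h1]; simp
      · rw [hinv v u, hinv w u, ← h s hs v hv w hw u hu hvw huw]; simp
    · simp [h1]
    · rw [hinv v u, hinv w v, hinv w u, ← h s hs w hw v hv u hu hvw huv]; simp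

end AbstractSimplicialComplex

/-! ### Central extensions, and the duality between H² and H₂ of a group. -/

namespace GroupMod2

/-- The 2-cocycle condition for trivial coefficients in `ZMod 2`. -/
def IsTwoCocycle {G : Type*} [Group G] (c : G → G → ZMod 2) : Prop :=
  ∀ x y z, c x y + c (x * y) z = c y z + c x (y * z)

/-- The 2-coboundary condition for trivial coefficients in `ZMod 2`. -/
def IsTwoCoboundary {G : Type*} [Group G] (c : G → G → ZMod 2) : Prop :=
  ∃ a : G → ZMod 2, ∀ x y, c x y = a x + a y + a (x * y)

theorem two_eq_zero : (2 : ZMod 2) = 0 := rfl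

/-- The underlying type of the central extension of `G` by `ZMod 2` defined by a 2-cocycle. -/
@[ext]
structure CentralExtension {G : Type*} (c : G → G → ZMod 2) where
  /-- the central coordinate -/
  fst : ZMod 2
  /-- the image in `G` -/
  snd : G

/-- The group structure of the central extension defined by a 2-cocycle. -/
@[reducible]
def IsTwoCocycle.group {G : Type*} [Group G] {c : G → G → ZMod 2} (hc : IsTwoCocycle c) :
    Group (CentralExtension c) :=
  letI : Mul (CentralExtension c) := ⟨fun p q => ⟨p.1 + q.1 + c p.2 q.2, p.2 * q.2⟩⟩
  -- The cocycle is not normalised, so the unit and the inverses carry the correction `c 1 1`.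
  letI : One (CentralExtension c) := ⟨⟨c 1 1, 1⟩⟩
  letI : Inv (CentralExtension c) := ⟨fun p => ⟨p.1 + c 1 1 + c p.2⁻¹ p.2, p.2⁻¹⟩⟩
  Group.ofLeftAxioms
    (fun p q r => CentralExtension.ext
      (show p.1 + q.1 + c p.2 q.2 + r.1 + c (p.2 * q.2) r.2 =
          p.1 + (q.1 + r.1 + c q.2 r.2) + c p.2 (q.2 * r.2) by
        linear_combination hc p.2 q.2 r.2)
      (mul_assoc _ _ _))
    (fun p => CentralExtension.ext
      (show c 1 1 + p.1 + c 1 p.2 = p.1 by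
        have := hc 1 1 p.2
        simp only [one_mul] at this
        linear_combination this + c 1 p.2 * two_eq_zero)
      (one_mul _))
    (fun p => CentralExtension.ext
      (show p.1 + c 1 1 + c p.2⁻¹ p.2 + p.1 + c p.2⁻¹ p.2 = c 1 1 by
        linear_combination (p.1 + c p.2⁻¹ p.2) * two_eq_zero)
      (inv_mul_cancel _))

/-- A 2-cocycle whose pullback along an edge cocycle is a coboundary on every triangle is itself a
coboundary, if sections can be constructed from lifts of the edge cocycle. -/
theorem IsTwoCocycle.isTwoCoboundary_of_edge {G : Type} [Group G] {c : G → G → ZMod 2}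
    (hc : IsTwoCocycle c) {V : Type*} [LinearOrder V] {K : AbstractSimplicialComplex V}
    {g : V → V → G} (hg : K.IsEdgeCocycle g)
    (hlift : ∀ {E : Type} [Group E] (q : E →* G) (e : V → V → E), K.IsEdgeCocycle e →
      (∀ s ∈ K.faces, ∀ u ∈ s, ∀ v ∈ s, q (e u v) = g u v) →
      ∃ σ : G →* E, q.comp σ = MonoidHom.id G)
    (b : V → V → ZMod 2)
    (hb : ∀ s ∈ K.faces, ∀ u ∈ s, ∀ v ∈ s, ∀ w ∈ s, u < v → v < w →
      c (g u v) (g v w) = b u v + b v w + b u w) : IsTwoCoboundary c := by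
  let _ := hc.group
  have hmul (p q : CentralExtension c) : p * q = ⟨p.1 + q.1 + c p.2 q.2, p.2 * q.2⟩ := rfl
  let q : CentralExtension c →* G :=
    { toFun := fun p => p.2
      map_one' := rfl
      map_mul' := fun _ _ => rfl }
  -- The lift is prescribed on increasing edges by the cochain `b`; reversed edges must receive
  -- group inverses, as `c` is not normalised.
  let e (u v : V) : CentralExtension c :=
    if u < v then ⟨b u v, g u v⟩ else if v < u then (⟨b v u, g v u⟩)⁻¹ else 1
  have helt {u v : V} (h : u < v) : e u v = ⟨b u v, g u v⟩ := if_pos h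
  have he1 (v : V) : e v v = 1 := by simp [e]
  have hegt {u v : V} (h : u < v) : e v u = (⟨b u v, g u v⟩)⁻¹ := by simp [e, h, h.asymm]
  have heinv (u v : V) : e v u = (e u v)⁻¹ := by
    rcases lt_trichotomy u v with h | rfl | h
    · rw [helt h, hegt h]
    · simp [he1]
    · rw [helt h, hegt h, inv_inv]
  have he : K.IsEdgeCocycle e := by
    refine AbstractSimplicialComplex.isEdgeCocycle_of_lt he1 heinv fun s hs u hu v hv w hw h h' => ?_
    rw [helt h, helt h', helt (h.trans h'), hmul]
    ext
    · simp only
      linear_combination hb s hs u hu v hv w hw h h' + (b u v + b v w) * two_eq_zero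
    · exact hg s hs u hu v hv w hw
  obtain ⟨σ, hσ⟩ := hlift q e he fun s hs u hu v hv => by
    have hinv : g v u = (g u v)⁻¹ := by
      rw [eq_inv_iff_mul_eq_one, hg s hs v hv u hu v hv, hg.apply_self]
    rcases lt_trichotomy u v with h | rfl | h
    · rw [helt h]; rfl
    · rw [he1, hg.apply_self, map_one]
    · rw [hegt h, map_inv, ← inv_inv (g u v), ← hinv]; rfl
  -- The central coordinate of a splitting is a primitive of `c`.
  refine ⟨fun x => (σ x).1, fun x y => ?_⟩
  have h2 (x : G) : (σ x).2 = x := DFunLike.congr_fun hσ x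
  simp only [map_mul, hmul, h2]
  linear_combination (-(σ x).1 - (σ y).1) * two_eq_zero

/-! ### Pairing of cochains with chains -/

open groupHomology

/-- The linear functional on the inhomogeneous 2-chains given by a 2-cochain. -/
def eval₂ {G : Type*} (c : G → G → ZMod 2) : (G × G →₀ ZMod 2) →ₗ[ZMod 2] ZMod 2 :=
  Finsupp.linearCombination (ZMod 2) fun p : G × G => c p.1 p.2

@[simp]
theorem eval₂_single {G : Type*} (c : G → G → ZMod 2) (p : G × G) (a : ZMod 2) :
    eval₂ c (Finsupp.single p a) = a * c p.1 p.2 := by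
  simp [eval₂]

variable {G : Type} [Group G]

theorem d₂₁_single_coeff (p : G × G) (a : ZMod 2) :
    (d₂₁ (coeff G)).hom (Finsupp.single p a) =
      Finsupp.single p.2 a - Finsupp.single (p.1 * p.2) a + Finsupp.single p.1 a := by
  simpa using d₂₁_single (A := coeff G) p a

theorem eval₂_eq_zero_of_mem_boundaries₂ {c : G → G → ZMod 2} (hc : IsTwoCocycle c)
    {z : G × G →₀ ZMod 2} (hz : z ∈ boundaries₂ (coeff G)) : eval₂ c z = 0 := by
  obtain ⟨w, rfl⟩ := hz
  induction w using Finsupp.induction_linear with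
  | zero => simp
  | add x y hx hy => rw [map_add, map_add, hx, hy, add_zero]
  | single p a =>
    have := d₃₂_single (A := coeff G) p a
    rw [this]
    simp only [map_add, map_sub, eval₂_single, Representation.isTrivial_def, LinearMap.id_apply]
    linear_combination -a * hc p.1 p.2.1 p.2.2

/-- Over a field, a functional that kills the kernel of the differential factors through the
differential; the factor is the primitive. -/
theorem isTwoCoboundary_iff {c : G → G → ZMod 2} :
    IsTwoCoboundary c ↔ ∀ z ∈ cycles₂ (coeff G), eval₂ c z = 0 := by
  constructor
  · rintro ⟨a, ha⟩ z hz
    have key : eval₂ c = (Finsupp.linearCombination (ZMod 2) a).comp (d₂₁ (coeff G)).hom := by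
      refine Finsupp.lhom_ext fun p r => ?_
      rw [LinearMap.comp_apply, d₂₁_single_coeff]
      simp only [eval₂_single, ha, map_add, map_sub, Finsupp.linearCombination_single, smul_eq_mul]
      linear_combination r * a (p.1 * p.2) * two_eq_zero
    have hz0 : (d₂₁ (coeff G)).hom z = 0 := hz
    rw [key, LinearMap.comp_apply, hz0, map_zero]
  · intro h
    have hmem : eval₂ c ∈ (LinearMap.ker (d₂₁ (coeff G)).hom).dualAnnihilator :=
      (Submodule.mem_dualAnnihilator _).2 h
    rw [← LinearMap.range_dualMap_eq_dualAnnihilator_ker] at hmem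
    obtain ⟨μ, hμ⟩ := hmem
    refine ⟨fun x => μ (Finsupp.single x (1 : ZMod 2)), fun x y => ?_⟩
    have := LinearMap.congr_fun hμ (Finsupp.single (x, y) (1 : ZMod 2))
    have h2 := d₂₁_single_coeff (x, y) (1 : ZMod 2)
    have h3 : μ ((d₂₁ (coeff G)).hom (Finsupp.single (x, y) (1 : ZMod 2))) = c x y := by
      simpa using this
    rw [← h3, h2]
    simp only [map_add, map_sub]
    linear_combination (-μ (Finsupp.single (x * y) (1 : ZMod 2))) * two_eq_zero

/-- Every functional on the second homology is given by a 2-cocycle. -/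
theorem exists_twoCocycle (l : H_ 2 G →ₗ[ZMod 2] ZMod 2) :
    ∃ c : G → G → ZMod 2, IsTwoCocycle c ∧
      ∀ z : cycles₂ (coeff G), l ((H2π (coeff G)).hom z) = eval₂ c z.1 := by
  -- Extended from cycles to all chains, the functional becomes a cochain; its vanishing on
  -- boundaries is the cocycle identity.
  obtain ⟨L, hL⟩ := LinearMap.exists_extend (l.comp (H2π (coeff G)).hom)
  have hL' (z : cycles₂ (coeff G)) : l ((H2π (coeff G)).hom z) = L z.1 :=
    (LinearMap.congr_fun hL z).symm
  have heval : L = eval₂ (fun x y => L (Finsupp.single (x, y) (1 : ZMod 2))) := by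
    refine Finsupp.lhom_ext fun p r => ?_
    rw [eval₂_single, ← smul_eq_mul, ← map_smul]
    congr 1
    exact (Finsupp.smul_single_one p r).symm
  refine ⟨fun x y => L (Finsupp.single (x, y) (1 : ZMod 2)), fun x y z => ?_,
    fun z => heval ▸ hL' z⟩
  have hb : (d₃₂ (coeff G)).hom (Finsupp.single (x, y, z) (1 : ZMod 2)) ∈
      boundaries₂ (coeff G) := ⟨_, rfl⟩
  have h0 := hL' ⟨_, boundaries₂_le_cycles₂ _ hb⟩
  have h1 : (H2π (coeff G)).hom ⟨_, boundaries₂_le_cycles₂ _ hb⟩ = 0 :=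
    (H2π_eq_zero_iff _).2 hb
  rw [h1, map_zero] at h0
  have h2 := d₃₂_single (A := coeff G) (x, y, z) (1 : ZMod 2)
  have h3 : L ((d₃₂ (coeff G)).hom (Finsupp.single (x, y, z) (1 : ZMod 2))) = 0 := h0.symm
  rw [h2] at h3
  simp only [map_add, map_sub, Representation.isTrivial_def, LinearMap.id_apply] at h3
  linear_combination -h3

theorem H2π_surjective : Function.Surjective (H2π (coeff G)).hom :=
  (ModuleCat.epi_iff_surjective _).1 inferInstance

/-- Every 1-chain is a 1-cycle for trivial coefficients. -/
def toCycles₁ : (G →₀ ZMod 2) →ₗ[ZMod 2] cycles₁ (coeff G) :=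
  LinearMap.codRestrict _ LinearMap.id fun _ => by
    rw [cycles₁_eq_top_of_isTrivial]; trivial

/-- The value of a functional on the first homology on the class of a group element. -/
def homOfDual : Module.Dual (ZMod 2) (H_ 1 G) →ₗ[ZMod 2] (G → ZMod 2) where
  toFun l x := l ((H1π (coeff G)).hom (toCycles₁ (Finsupp.single x (1 : ZMod 2))))
  map_add' _ _ := rfl
  map_smul' _ _ := rfl

theorem homOfDual_mul (l : Module.Dual (ZMod 2) (H_ 1 G)) (x y : G) :
    homOfDual l (x * y) = homOfDual l x + homOfDual l y := by
  have hb : (toCycles₁ ((d₂₁ (coeff G)).hom (Finsupp.single (x, y) (1 : ZMod 2)))).1 ∈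
      boundaries₁ (coeff G) := ⟨_, rfl⟩
  have h1 := (H1π_eq_zero_iff _).2 hb
  have h2 := congrArg l h1
  rw [map_zero, d₂₁_single_coeff, map_add, map_sub] at h2
  change l ((H1π (coeff G)).hom _) = 0 at h2
  rw [map_add, map_sub, map_add, map_sub] at h2
  change homOfDual l y - homOfDual l (x * y) + homOfDual l x = 0 at h2
  linear_combination -h2

theorem homOfDual_injective : Function.Injective (homOfDual (G := G)) := by
  rw [injective_iff_map_eq_zero]
  intro l hl
  have h0 : (l.comp (H1π (coeff G)).hom).comp toCycles₁ = 0 := by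
    refine Finsupp.lhom_ext' fun x => LinearMap.ext_ring ?_
    exact congrFun hl x
  ext w
  obtain ⟨z, rfl⟩ := (ModuleCat.epi_iff_surjective (H1π (coeff G))).1 inferInstance w
  exact LinearMap.congr_fun h0 z.1

theorem finrank_H_zero : Module.finrank (ZMod 2) (H_ 0 G) = 1 := by
  rw [(H0IsoOfIsTrivial (coeff G)).toLinearEquiv.finrank_eq]
  exact Module.finrank_self (ZMod 2)

theorem toHom_surjective : Function.Surjective (toHom (G := G)) := by
  intro α
  obtain ⟨a, ha⟩ := (groupCohomology.H1IsoOfIsTrivial (coeff G)).toLinearEquiv.surjective α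
  exact ⟨a, ha⟩

theorem PropertyA.exists_not_isTwoCoboundary (hA : PropertyA G) (α : Additive G →+ ZMod 2)
    (hα : α ≠ 0) : ∃ β : Additive G →+ ZMod 2,
      ¬ IsTwoCoboundary fun x y : G => α (Additive.ofMul x) * β (Additive.ofMul y) := by
  obtain ⟨a, rfl⟩ := toHom_surjective α
  have h0 : toHom (0 : groupCohomology (coeff G) 1) = 0 :=
    map_zero (groupCohomology.H1IsoOfIsTrivial (coeff G)).toLinearEquiv
  obtain ⟨b, hb⟩ := hA a fun h => hα (h ▸ h0)
  refine ⟨toHom b, fun ⟨f, hf⟩ => hb ?_⟩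
  rw [cup, groupCohomology.H2π_eq_zero_iff]
  refine ⟨f, ?_⟩
  funext ⟨x, y⟩
  refine Eq.trans ?_ (hf x y).symm
  change f y - f (x * y) + f x = _
  linear_combination -f (x * y) * two_eq_zero

end GroupMod2

/-! ### Linear algebra of a finite family of triangles. -/

namespace TriangleFamily

variable {V : Type*} [LinearOrder V]

theorem exists_lt_lt {t : Finset V} (ht : t.card = 3) :
    ∃ u v w, u < v ∧ v < w ∧ t = {u, v, w} := by
  obtain ⟨a, b, c, hab, hac, hbc, rfl⟩ := Finset.card_eq_three.1 ht
  rcases lt_or_gt_of_ne hab with h1 | h1 <;> rcases lt_or_gt_of_ne hac with h2 | h2 <;>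
    rcases lt_or_gt_of_ne hbc with h3 | h3
  · exact ⟨a, b, c, h1, h3, rfl⟩
  · exact ⟨a, c, b, h2, h3, by grind⟩
  · exact absurd (h1.trans h3) h2.asymm
  · exact ⟨c, a, b, h2, h1, by grind⟩
  · exact ⟨b, a, c, h1, h2, by grind⟩
  · exact absurd (h1.trans h2) h3.asymm
  · exact ⟨b, c, a, h3, h2, by grind⟩
  · exact ⟨c, b, a, h3, h1, by grind⟩

theorem eq_of_lt_lt {u v w u' v' w' : V} (h : u < v) (h' : v < w) (k : u' < v') (k' : v' < w')
    (he : ({u, v, w} : Finset V) = {u', v', w'}) : u = u' ∧ v = v' ∧ w = w' := by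
  have h1 : u ∈ ({u', v', w'} : Finset V) := he ▸ by simp
  have h2 : v ∈ ({u', v', w'} : Finset V) := he ▸ by simp
  have h3 : w ∈ ({u', v', w'} : Finset V) := he ▸ by simp
  simp only [Finset.mem_insert, Finset.mem_singleton] at h1 h2 h3
  have := h.trans h'
  have := k.trans k'
  grind

theorem sum_powersetCard_two {M : Type*} [AddCommMonoid M] (m : Finset V → M) {u v w : V}
    (h : u < v) (h' : v < w) :
    ∑ e ∈ ({u, v, w} : Finset V).powersetCard 2, m e = m {u, v} + m {v, w} + m {u, w} := by
  have hs : ({u, v, w} : Finset V).powersetCard 2 = {{u, v}, {v, w}, {u, w}} := by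
    ext e
    simp only [Finset.mem_powersetCard, Finset.mem_insert, Finset.mem_singleton]
    constructor
    · rintro ⟨h1, h2⟩
      obtain ⟨a, b, hab, rfl⟩ := Finset.card_eq_two.1 h2
      have ha := h1 (Finset.mem_insert_self a {b})
      have hb := h1 (show b ∈ ({a, b} : Finset V) by simp)
      simp only [Finset.mem_insert, Finset.mem_singleton] at ha hb
      grind
    · have h'' := h.trans h'
      rintro (rfl | rfl | rfl) <;>
        refine ⟨by grind, Finset.card_pair (by first | exact h.ne | exact h'.ne | exact h''.ne)⟩
  have h'' := h.trans h'
  have n1 : ({u, v} : Finset V) ≠ {v, w} := fun he => by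
    have : u ∈ ({v, w} : Finset V) := he ▸ by simp
    grind
  have n2 : ({u, v} : Finset V) ≠ {u, w} := fun he => by
    have : v ∈ ({u, w} : Finset V) := he ▸ by simp
    grind
  have n3 : ({v, w} : Finset V) ≠ {u, w} := fun he => by
    have : v ∈ ({u, w} : Finset V) := he ▸ by simp
    grind
  rw [hs, Finset.sum_insert (by simp [n1, n2]), Finset.sum_insert (by simp [n3]),
    Finset.sum_singleton, add_assoc]

theorem exists_pairFunction {M : Type*} [Inhabited M] (f : V → V → M) :
    ∃ m : Finset V → M, ∀ u v, u < v → m {u, v} = f u v := by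
  refine ⟨fun e => if h : e.Nonempty then f (e.min' h) (e.max' h) else default, fun u v h => ?_⟩
  have hn : ({u, v} : Finset V).Nonempty := by simp
  refine (dif_pos hn).trans ?_
  have h1 : ({u, v} : Finset V).min' hn = u :=
    le_antisymm (Finset.min'_le _ _ (by simp))
      (Finset.le_min' _ _ _ fun x hx => by
        simp only [Finset.mem_insert, Finset.mem_singleton] at hx
        rcases hx with rfl | rfl
        exacts [le_rfl, h.le])
  have h2 : ({u, v} : Finset V).max' hn = v :=
    le_antisymm (Finset.max'_le _ _ _ fun x hx => by
        simp only [Finset.mem_insert, Finset.mem_singleton] at hx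
        rcases hx with rfl | rfl
        exacts [h.le, le_rfl]) (Finset.le_max' _ _ (by simp))
  rw [h1, h2]

/-- The edges of the triangles of a family. -/
def edges (S : Finset (Finset V)) : Finset (Finset V) := S.biUnion (Finset.powersetCard 2)

theorem mem_edges {S : Finset (Finset V)} {e : Finset V} :
    e ∈ edges S ↔ ∃ t ∈ S, e ⊆ t ∧ e.card = 2 := by
  simp [edges, Finset.mem_powersetCard]

theorem sum_edges_of_mem {M : Type*} [AddCommMonoid M] {S : Finset (Finset V)} {t : Finset V}
    (ht : t ∈ S) (f : Finset V → M) :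
    ∑ e : edges S, (if e.1 ⊆ t then f e.1 else 0) = ∑ e ∈ t.powersetCard 2, f e := by
  rw [Finset.sum_coe_sort (edges S) fun e => if e ⊆ t then f e else 0, ← Finset.sum_filter]
  refine Finset.sum_congr ?_ fun _ _ => rfl
  ext e
  rw [Finset.mem_filter, mem_edges, Finset.mem_powersetCard]
  exact ⟨fun ⟨⟨_, _, _, h⟩, h'⟩ => ⟨h', h⟩, fun ⟨h, h'⟩ => ⟨⟨t, ht, h, h'⟩, h⟩⟩

/-- The incidence matrix between the edges and the triangles of a family. -/
def incidence (S : Finset (Finset V)) : Matrix (edges S) S (ZMod 2) :=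
  Matrix.of fun e t => if e.1 ⊆ t.1 then 1 else 0

theorem incidence_mulVec (S : Finset (Finset V)) (y : S → ZMod 2) (e : edges S) :
    (incidence S).mulVec y e = ∑ t : S, if e.1 ⊆ t.1 then y t else 0 := by
  simp [incidence, Matrix.mulVec, dotProduct]

variable [Fintype V]

/-- The mod 2 boundary, on all `ZMod 2`-valued functions on finite sets of vertices: a set is sent
to the sum of its two-element subsets. -/
def bdry : (Finset V → ZMod 2) →ₗ[ZMod 2] (Finset V → ZMod 2) :=
  Fintype.linearCombination (ZMod 2) fun t => ∑ e ∈ t.powersetCard 2, Pi.single e 1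

theorem bdry_apply (z : Finset V → ZMod 2) (e : Finset V) :
    bdry z e = ∑ t, if e ∈ t.powersetCard 2 then z t else 0 := by
  simp only [bdry, Fintype.linearCombination_apply, Finset.sum_apply, Pi.smul_apply, smul_eq_mul]
  refine Finset.sum_congr rfl fun t _ => ?_
  simp only [Pi.single_apply, Finset.sum_ite_eq, mul_ite, mul_one, mul_zero]

/-- The cycles carried by a family of triangles. -/
def cyclesOn (S : Finset (Finset V)) : Submodule (ZMod 2) (Finset V → ZMod 2) where
  carrier := {z | bdry z = 0 ∧ ∀ t ∉ S, z t = 0}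
  add_mem' hx hy := ⟨by rw [map_add, hx.1, hy.1, add_zero],
    fun t ht => by rw [Pi.add_apply, hx.2 t ht, hy.2 t ht, add_zero]⟩
  zero_mem' := ⟨map_zero _, fun _ _ => rfl⟩
  smul_mem' c x hx := ⟨by rw [map_smul, hx.1, smul_zero],
    fun t ht => by rw [Pi.smul_apply, hx.2 t ht, smul_zero]⟩

/-- Stokes: on `S` the cochain `F` is the coboundary of `f`, so its pairing with a cycle vanishes.
Coefficients in `M` let it serve for chain maps as well as for cocycles. -/
theorem sum_smul_eq_zero {M : Type*} [AddCommGroup M] [Module (ZMod 2) M] {S : Finset (Finset V)}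
    {z : Finset V → ZMod 2} (hz : z ∈ cyclesOn S) (f : V → V → M) (F : Finset V → M)
    (hF : ∀ t ∈ S, ∃ u v w, u < v ∧ v < w ∧ t = {u, v, w} ∧ F t = f u v + f v w + f u w) :
    ∑ t, z t • F t = 0 := by
  have : Inhabited M := ⟨0⟩
  obtain ⟨m, hm⟩ := exists_pairFunction f
  have h1 : Fintype.linearCombination (ZMod 2) m (bdry z) = 0 := by rw [hz.1, map_zero]
  have h2 : bdry z = ∑ t, z t • ∑ e ∈ t.powersetCard 2, Pi.single e 1 :=
    Fintype.linearCombination_apply _ _ _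
  rw [← h1, h2, map_sum]
  refine Finset.sum_congr rfl fun t _ => ?_
  by_cases ht : t ∈ S
  · obtain ⟨u, v, w, h, h', rfl, hFt⟩ := hF t ht
    rw [hFt, map_smul, map_sum]
    simp only [Fintype.linearCombination_apply_single, one_smul]
    rw [sum_powersetCard_two m h h', hm _ _ h, hm _ _ h', hm _ _ (h.trans h')]
  · rw [hz.2 t ht, zero_smul, zero_smul, map_zero]

theorem mem_cyclesOn_iff {S : Finset (Finset V)} {z : Finset V → ZMod 2} :
    z ∈ cyclesOn S ↔ (incidence S).mulVec (fun t => z t.1) = 0 ∧ ∀ t ∉ S, z t = 0 := by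
  refine and_congr_left fun hz => ?_
  have key (e : Finset V) (he : e ∈ edges S) :
      (incidence S).mulVec (fun t => z t.1) ⟨e, he⟩ = bdry z e := by
    have hcard := (mem_edges.1 he).choose_spec.2.2
    rw [bdry_apply, incidence_mulVec]
    simp only [Finset.mem_powersetCard, hcard, and_true]
    rw [Finset.sum_coe_sort S fun t => if e ⊆ t then z t else 0]
    refine Finset.sum_subset (Finset.subset_univ _) fun t _ ht => ?_
    rw [hz t ht, ite_self]
  constructor
  · intro h
    ext ⟨e, he⟩
    rw [key, h]
    rfl
  · intro h
    ext e
    by_cases he : e ∈ edges S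
    · rw [← key e he, h]
      rfl
    · rw [bdry_apply]
      refine Finset.sum_eq_zero fun t _ => ?_
      by_cases ht : t ∈ S
      · rw [if_neg]
        intro h
        exact he (Finset.mem_biUnion.2 ⟨t, ht, h⟩)
      · rw [hz t ht, ite_self]

/-- Cycles on a family of triangles are the kernel of the incidence matrix. -/
def cyclesEquiv (S : Finset (Finset V)) :
    cyclesOn S ≃ₗ[ZMod 2] LinearMap.ker (incidence S).mulVecLin :=
  LinearEquiv.ofBijective
    ((LinearMap.funLeft (ZMod 2) (ZMod 2) (Subtype.val : S → Finset V)).restrict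
      (q := LinearMap.ker (incidence S).mulVecLin) fun z hz => (mem_cyclesOn_iff.1 hz).1) <| by
    constructor
    · intro x y h
      ext t
      by_cases ht : t ∈ S
      · exact congrFun (congrArg Subtype.val h) ⟨t, ht⟩
      · rw [x.2.2 t ht, y.2.2 t ht]
    · rintro ⟨y, hy⟩
      have hy' : (fun t : S => if h : t.1 ∈ S then y ⟨t.1, h⟩ else 0) = y := by
        ext t
        simp
      refine ⟨⟨fun t => if h : t ∈ S then y ⟨t, h⟩ else 0, mem_cyclesOn_iff.2 ⟨?_, ?_⟩⟩, ?_⟩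
      · rw [hy']; exact hy
      · intro t ht
        exact dif_neg ht
      · exact Subtype.ext hy'

/-- The cycles are the kernel of the incidence matrix, so `k` factors through that matrix; the
factor, read on edges, is `b`. -/
theorem exists_of_eq_zero_on_cycles {S : Finset (Finset V)}
    (k : Finset V → ZMod 2) (hk : ∀ z ∈ cyclesOn S, ∑ t, z t * k t = 0) :
    ∃ b : Finset V → ZMod 2, ∀ t ∈ S, k t = ∑ e ∈ t.powersetCard 2, b e := by
  let ν : Module.Dual (ZMod 2) (S → ZMod 2) := Fintype.linearCombination (ZMod 2) fun t => k t.1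
  have hν : ν ∈ (LinearMap.ker (incidence S).mulVecLin).dualAnnihilator := by
    rw [Submodule.mem_dualAnnihilator]
    intro y hy
    obtain ⟨z, hz⟩ := (cyclesEquiv S).surjective ⟨y, hy⟩
    have hzy : (fun t : S => z.1 t.1) = y := congrArg Subtype.val hz
    rw [← hzy, ← hk z.1 z.2, Fintype.linearCombination_apply]
    simp only [smul_eq_mul]
    rw [Finset.sum_coe_sort S fun t => z.1 t * k t]
    refine Finset.sum_subset (Finset.subset_univ _) fun t _ ht => ?_
    rw [z.2.2 t ht, zero_mul]
  rw [← LinearMap.range_dualMap_eq_dualAnnihilator_ker] at hν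
  obtain ⟨μ, hμ⟩ := hν
  refine ⟨fun e => if he : e ∈ edges S then μ (Pi.single ⟨e, he⟩ 1) else 0, fun t ht => ?_⟩
  have h1 := LinearMap.congr_fun hμ (Pi.single ⟨t, ht⟩ 1)
  simp only [ν, Fintype.linearCombination_apply_single, one_smul] at h1
  rw [← h1, LinearMap.dualMap_apply, Matrix.mulVecLin_apply, Matrix.mulVec_single_one]
  have h2 : (incidence S).col ⟨t, ht⟩ =
      ∑ e : edges S, (if e.1 ⊆ t then (1 : ZMod 2) else 0) • Pi.single e 1 := by
    ext e
    simp only [Matrix.col_apply, incidence, Matrix.of_apply, Finset.sum_apply, Pi.smul_apply,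
      Pi.single_apply, smul_eq_mul, mul_ite, mul_one, mul_zero, Finset.sum_ite_eq,
      Finset.mem_univ, if_true]
  rw [h2, map_sum]
  have h3 (e : edges S) : μ ((if e.1 ⊆ t then (1 : ZMod 2) else 0) • Pi.single e 1) =
      if e.1 ⊆ t then (if he : e.1 ∈ edges S then μ (Pi.single ⟨e.1, he⟩ 1) else 0) else 0 := by
    rw [map_smul, smul_eq_mul, ite_mul, one_mul, zero_mul, dif_pos e.2]
  rw [Finset.sum_congr rfl fun e _ => h3 e]
  exact sum_edges_of_mem ht fun e => if he : e ∈ edges S then μ (Pi.single ⟨e, he⟩ 1) else 0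

end TriangleFamily

/-! ### Components, minimal families, the map to `H_ 2 G`, and the dimension count. -/

namespace TriangleFamily

open groupHomology GroupMod2

variable {V : Type*}

/-! ### Components -/

/-- Two vertices are equivalent if no function that is constant on the triangles of the family
separates them, i.e. if they lie in the same component. -/
def component (S : Finset (Finset V)) : Setoid V where
  r u v := ∀ h : V → ZMod 2, (∀ t ∈ S, ∀ a ∈ t, ∀ b ∈ t, h a = h b) → h u = h v
  iseqv := ⟨fun _ _ _ => rfl, fun H h hh => (H h hh).symm,
    fun H H' h hh => (H h hh).trans (H' h hh)⟩

/-- A chosen vertex in the component of a vertex. -/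
def root (S : Finset (Finset V)) (v : V) : V := (Quotient.mk (component S) v).out

theorem root_eq_iff {S : Finset (Finset V)} {u v : V} :
    root S u = root S v ↔ (component S) u v :=
  Quotient.out_inj.trans Quotient.eq

theorem component_root (S : Finset (Finset V)) (v : V) : (component S) (root S v) v :=
  Quotient.mk_out v

theorem root_root (S : Finset (Finset V)) (v : V) : root S (root S v) = root S v :=
  root_eq_iff.2 (component_root S v)

theorem component_of_mem {S : Finset (Finset V)} {t : Finset V} (ht : t ∈ S) {u v : V}
    (hu : u ∈ t) (hv : v ∈ t) : (component S) u v :=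
  fun _ hh => hh t ht u hu v hv

/-- The vertices that are not the chosen vertex of their component. -/
abbrev NonRoot (S : Finset (Finset V)) : Type _ := {v : V // root S v ≠ v}

variable [LinearOrder V] [Fintype V]

theorem cyclesOn_mono {S S' : Finset (Finset V)} (h : S ⊆ S') : cyclesOn S ≤ cyclesOn S' :=
  fun _ hz => ⟨hz.1, fun t ht => hz.2 t fun ht' => ht (h ht')⟩

/-- A linear surjection from the cycles of a family of triangles becomes an isomorphism on a
minimal subfamily on which it is still surjective; every triangle of that subfamily supports a
cycle. -/
theorem exists_minimal_family {H : Type*} [AddCommGroup H] [Module (ZMod 2) H]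
    {S₀ : Finset (Finset V)} (Φ : cyclesOn S₀ →ₗ[ZMod 2] H) (hΦ : Function.Surjective Φ) :
    ∃ (S : Finset (Finset V)) (hS : S ⊆ S₀),
      Function.Bijective (Φ ∘ₗ Submodule.inclusion (cyclesOn_mono hS)) ∧
      ∀ t ∈ S, ∃ z ∈ cyclesOn S, z t ≠ 0 := by
  obtain ⟨S, -, ⟨hS, hsurj⟩, hmin⟩ := exists_minimal_le_of_wellFoundedLT
    (fun S : Finset (Finset V) => ∃ hS : S ⊆ S₀,
      Function.Surjective (Φ ∘ₗ Submodule.inclusion (cyclesOn_mono hS))) S₀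
    ⟨subset_rfl, fun y => by obtain ⟨z, hz⟩ := hΦ y; exact ⟨z, hz⟩⟩
  have hmin' {t : Finset V} (ht : t ∈ S) (h : ∀ y, ∃ z : cyclesOn S, z.1 t = 0 ∧
      Φ (Submodule.inclusion (cyclesOn_mono hS) z) = y) : False := by
    refine Finset.notMem_erase t S (hmin ⟨(Finset.erase_subset t S).trans hS, fun y => ?_⟩
      (Finset.erase_subset t S) ht)
    obtain ⟨z, hz, hzy⟩ := h y
    refine ⟨⟨z.1, z.2.1, fun t' ht' => ?_⟩, hzy⟩
    by_cases h' : t' = t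
    · rw [h', hz]
    · exact z.2.2 t' fun h'' => ht' (Finset.mem_erase.2 ⟨h', h''⟩)
  refine ⟨S, hS, ⟨(injective_iff_map_eq_zero _).2 fun z hz => ?_, hsurj⟩, fun t ht => ?_⟩
  · by_contra hne
    obtain ⟨t, ht⟩ : ∃ t, z.1 t ≠ 0 := by
      by_contra! h
      exact hne (Subtype.ext (funext h))
    have htS : t ∈ S := by_contra fun h => ht (z.2.2 t h)
    refine hmin' htS fun y => ?_
    obtain ⟨z', hz'⟩ := hsurj y
    have hz1 : z.1 t = 1 := Fin.eq_one_of_ne_zero _ ht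
    -- Subtracting the kernel element `z` clears the coefficient at `t` without changing the image,
    -- so `t` could be removed.
    refine ⟨z' - z'.1 t • z, ?_, ?_⟩
    · simp [hz1]
    · rw [map_sub, map_sub, map_smul, map_smul]
      have : Φ (Submodule.inclusion (cyclesOn_mono hS) z) = 0 := hz
      rw [this, smul_zero, sub_zero]
      exact hz'
  · by_contra! h
    refine hmin' ht fun y => ?_
    obtain ⟨z, hz⟩ := hsurj y
    exact ⟨z, h z.1 z.2, hz⟩

variable {G : Type} [Group G]

/-- `τ` assigns to each triangle of `S` the bar 2-simplex given by the edge labelling `g`. -/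
def IsLabelling (g : V → V → G) (S : Finset (Finset V)) (τ : Finset V → G × G) : Prop :=
  ∀ t ∈ S, ∃ u v w, u < v ∧ v < w ∧ t = {u, v, w} ∧ τ t = (g u v, g v w) ∧
    g u v * g v w = g u w

theorem IsLabelling.mono {V : Type*} [LinearOrder V] {g : V → V → G} {S S' : Finset (Finset V)}
    {τ : Finset V → G × G} (h : IsLabelling g S τ) (hS : S' ⊆ S) : IsLabelling g S' τ :=
  fun t ht => h t (hS ht)

/-- The linear map sending each triangle to the bar 2-simplex `τ` assigns to it. -/
def chainMap {V G : Type*} [Fintype V] (τ : Finset V → G × G) : (Finset V → ZMod 2) →ₗ[ZMod 2] (G × G →₀ ZMod 2) :=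
  Fintype.linearCombination (ZMod 2) fun t => Finsupp.single (τ t) 1

theorem chainMap_apply {V G : Type*} [Fintype V] (τ : Finset V → G × G) (z : Finset V → ZMod 2) :
    chainMap τ z = ∑ t, z t • Finsupp.single (τ t) (1 : ZMod 2) :=
  Fintype.linearCombination_apply _ _ _

theorem eval₂_chainMap {V G : Type*} [Fintype V] (c : G → G → ZMod 2) (τ : Finset V → G × G) (z : Finset V → ZMod 2) :
    eval₂ c (chainMap τ z) = ∑ t, z t * c (τ t).1 (τ t).2 := by
  rw [chainMap_apply, map_sum]
  simp

theorem chainMap_mem_cycles₂ {g : V → V → G} {S : Finset (Finset V)} {τ : Finset V → G × G}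
    (hτ : IsLabelling g S τ) {z : Finset V → ZMod 2} (hz : z ∈ cyclesOn S) :
    chainMap τ z ∈ cycles₂ (coeff G) := by
  change (d₂₁ (coeff G)).hom (chainMap τ z) = 0
  rw [chainMap_apply, map_sum]
  simp only [map_smul]
  refine sum_smul_eq_zero (M := G →₀ ZMod 2) hz (fun u v => Finsupp.single (g u v) 1)
    (fun t => (d₂₁ (coeff G)).hom (Finsupp.single (τ t) (1 : ZMod 2))) fun t ht => ?_
  obtain ⟨u, v, w, h, h', htt, hτt, hg⟩ := hτ t ht
  refine ⟨u, v, w, h, h', htt, ?_⟩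
  rw [d₂₁_single_coeff, hτt]
  dsimp only
  rw [hg]
  ext x
  simp only [Finsupp.coe_add, Finsupp.coe_sub, Pi.add_apply, CharTwo.sub_eq_add]
  ring

/-- The map induced by an edge labelling on the second homology. -/
def homologyMap {g : V → V → G} {S : Finset (Finset V)} {τ : Finset V → G × G}
    (hτ : IsLabelling g S τ) : cyclesOn S →ₗ[ZMod 2] H_ 2 G :=
  (H2π (coeff G)).hom ∘ₗ (chainMap τ).restrict fun _ hz => chainMap_mem_cycles₂ hτ hz

/-- The map on second homology is surjective if it detects coboundaries. -/
theorem homologyMap_surjective {g : V → V → G} {S : Finset (Finset V)} {τ : Finset V → G × G}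
    (hτ : IsLabelling g S τ)
    (h : ∀ c : G → G → ZMod 2, IsTwoCocycle c → ∀ b : V → V → ZMod 2,
      (∀ u v w, u < v → v < w → {u, v, w} ∈ S →
        c (g u v) (g v w) = b u v + b v w + b u w) → IsTwoCoboundary c) :
    Function.Surjective (homologyMap hτ) := by
  rw [← LinearMap.range_eq_top]
  by_contra hne
  obtain ⟨l, hl0, hl⟩ := Submodule.exists_le_ker_of_lt_top _ (lt_top_iff_ne_top.2 hne)
  obtain ⟨c, hc, hlc⟩ := exists_twoCocycle l
  have hzero (z : Finset V → ZMod 2) (hz : z ∈ cyclesOn S) :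
      ∑ t, z t * c (τ t).1 (τ t).2 = 0 := by
    rw [← eval₂_chainMap]
    exact (hlc ⟨chainMap τ z, chainMap_mem_cycles₂ hτ hz⟩).symm.trans
      (hl ⟨⟨z, hz⟩, rfl⟩)
  obtain ⟨b, hb⟩ := exists_of_eq_zero_on_cycles (fun t => c (τ t).1 (τ t).2) hzero
  have hcob := h c hc (fun u v => b {u, v}) fun u v w huv hvw ht => by
    have h1 := hb _ ht
    rw [sum_powersetCard_two b huv hvw] at h1
    obtain ⟨u', v', w', hu, hv, he, hτt, -⟩ := hτ _ ht
    obtain ⟨rfl, rfl, rfl⟩ := eq_of_lt_lt huv hvw hu hv he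
    simpa only [hτt] using h1
  refine hl0 (LinearMap.ext fun y => ?_)
  obtain ⟨w, rfl⟩ := H2π_surjective y
  rw [hlc, isTwoCoboundary_iff.1 hcob _ w.2, LinearMap.zero_apply]

/-- Under property (A), a homomorphism to `ZMod 2` that is a coboundary on a family of triangles
carrying the second homology is zero. -/
theorem hom_eq_zero_of_coboundary (hA : PropertyA G) {g : V → V → G} {S : Finset (Finset V)}
    {τ : Finset V → G × G} (hτ : IsLabelling g S τ)
    (hsurj : Function.Surjective (homologyMap hτ)) (α : Additive G →+ ZMod 2) (h : V → ZMod 2)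
    (hα : ∀ t ∈ S, ∀ u ∈ t, ∀ v ∈ t, u < v → α (Additive.ofMul (g u v)) = h u + h v) :
    α = 0 := by
  by_contra hne
  obtain ⟨β, hβ⟩ := hA.exists_not_isTwoCoboundary α hne
  set c : G → G → ZMod 2 := fun x y => α (Additive.ofMul x) * β (Additive.ofMul y) with hc
  have hcc : IsTwoCocycle c := fun x y z => by
    simp only [hc, ofMul_mul, map_add]
    ring
  refine hβ (isTwoCoboundary_iff.2 fun w hw => ?_)
  -- The cycle `w` may be replaced by a homologous one coming from `S`.
  obtain ⟨z, hz⟩ := hsurj ((H2π (coeff G)).hom ⟨w, hw⟩)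
  have hbd := eval₂_eq_zero_of_mem_boundaries₂ hcc ((H2π_eq_iff _ _).1 hz)
  rw [map_sub, sub_eq_zero] at hbd
  refine hbd.symm.trans ?_
  change eval₂ c (chainMap τ z.1) = 0
  rw [eval₂_chainMap]
  -- On `S`, α = δh, whence α ∪ β = δ(h ∪ β).
  refine sum_smul_eq_zero (M := ZMod 2) z.2 (fun u v => h u * β (Additive.ofMul (g u v)))
    (fun t => c (τ t).1 (τ t).2) fun t ht => ?_
  obtain ⟨u, v, w, huv, hvw, htt, hτt, hg⟩ := hτ t ht
  refine ⟨u, v, w, huv, hvw, htt, ?_⟩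
  have h1 := hα t ht u (by simp [htt]) v (by simp [htt]) huv
  rw [hτt, ← hg]
  simp only [hc, h1, ofMul_mul, map_add]
  linear_combination -h u * β (Additive.ofMul (g u v)) * two_eq_zero

/-! ### The dimension count -/

/-- The map is `(l, h) ↦ g^* l + δh`, into the 1-cocycles of `S`. If it vanishes, `l` is a
coboundary on `S`, so `l = 0` by property (A); then `h` is constant on components and zero at their
roots, hence zero. -/
theorem exists_cochainMap [Nonempty V] {g : V → V → G} {S : Finset (Finset V)} {τ : Finset V → G × G}
    (hA : PropertyA G) (hτ : IsLabelling g S τ)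
    (hsurj : Function.Surjective (homologyMap hτ)) :
    ∃ Θ : (Module.Dual (ZMod 2) (H_ 1 G) × (NonRoot S → ZMod 2)) →ₗ[ZMod 2]
      LinearMap.ker (incidence S).transpose.mulVecLin, Function.Injective Θ := by
  have : Inhabited (V × V) := Classical.inhabited_of_nonempty inferInstance
  obtain ⟨ends, hends⟩ := exists_pairFunction (fun u v : V => (u, v))
  let ext := Function.ExtendByZero.linearMap (ZMod 2) (Subtype.val : NonRoot S → V)
  let Θ₀ : (Module.Dual (ZMod 2) (H_ 1 G) × (NonRoot S → ZMod 2)) →ₗ[ZMod 2]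
      (edges S → ZMod 2) :=
    ((LinearMap.funLeft (ZMod 2) (ZMod 2)
      (fun e : edges S => g (ends e.1).1 (ends e.1).2)) ∘ₗ homOfDual).coprod
      ((LinearMap.funLeft (ZMod 2) (ZMod 2) (fun e : edges S => (ends e.1).1) +
        LinearMap.funLeft (ZMod 2) (ZMod 2) (fun e : edges S => (ends e.1).2)) ∘ₗ ext)
  have hΘ₀ (p : Module.Dual (ZMod 2) (H_ 1 G) × (NonRoot S → ZMod 2)) (u v : V) (h : u < v)
      (he : {u, v} ∈ edges S) :
      Θ₀ p ⟨{u, v}, he⟩ = homOfDual p.1 (g u v) + (ext p.2 u + ext p.2 v) := by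
    simp [Θ₀, LinearMap.funLeft_apply, hends u v h]
  have hmem (p) : (incidence S).transpose.mulVecLin (Θ₀ p) = 0 := by
    ext ⟨t, ht⟩
    let Y (e : Finset V) : ZMod 2 := homOfDual p.1 (g (ends e).1 (ends e).2) +
      (ext p.2 (ends e).1 + ext p.2 (ends e).2)
    have h1 : (incidence S).transpose.mulVecLin (Θ₀ p) ⟨t, ht⟩ =
        ∑ e : edges S, if e.1 ⊆ t then Y e.1 else 0 := by
      simp only [Matrix.mulVecLin_apply, Matrix.mulVec, dotProduct, Matrix.transpose_apply,
        incidence, Matrix.of_apply, ite_mul, one_mul, zero_mul]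
      rfl
    rw [h1, sum_edges_of_mem ht Y]
    obtain ⟨u, v, w, huv, hvw, rfl, -, hg⟩ := hτ t ht
    rw [sum_powersetCard_two Y huv hvw]
    simp only [Y, hends _ _ huv, hends _ _ hvw, hends _ _ (huv.trans hvw), ← hg, homOfDual_mul,
      Pi.zero_apply]
    linear_combination (homOfDual p.1 (g u v) + homOfDual p.1 (g v w) + ext p.2 u + ext p.2 v +
      ext p.2 w) * two_eq_zero
  refine ⟨Θ₀.codRestrict _ hmem, ?_⟩
  rw [injective_iff_map_eq_zero]
  rintro p hp
  have hp' : Θ₀ p = 0 := congrArg Subtype.val hp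
  have hedge (t) (ht : t ∈ S) (u) (hu : u ∈ t) (v) (hv : v ∈ t) (h : u < v) :
      homOfDual p.1 (g u v) = ext p.2 u + ext p.2 v := by
    have he : {u, v} ∈ edges S := mem_edges.2 ⟨t, ht, by grind, Finset.card_pair h.ne⟩
    have := hΘ₀ p u v h he
    rw [hp'] at this
    exact (CharTwo.add_eq_zero.1 this.symm)
  let α : Additive G →+ ZMod 2 :=
    AddMonoidHom.mk' (fun x => homOfDual p.1 x.toMul) fun x y => homOfDual_mul _ _ _
  have hα := hom_eq_zero_of_coboundary hA hτ hsurj α (ext p.2) hedge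
  have h1 : homOfDual p.1 = 0 := funext fun x => DFunLike.congr_fun hα (Additive.ofMul x)
  have hp1 : p.1 = 0 := homOfDual_injective (by rw [h1, map_zero])
  have hconst : ∀ t ∈ S, ∀ a ∈ t, ∀ b ∈ t, ext p.2 a = ext p.2 b := by
    intro t ht a ha b hb
    rcases lt_trichotomy a b with h | rfl | h
    · have := hedge t ht a ha b hb h
      rw [h1] at this
      exact CharTwo.add_eq_zero.1 this.symm
    · rfl
    · have := hedge t ht b hb a ha h
      rw [h1] at this
      exact (CharTwo.add_eq_zero.1 this.symm).symm
  refine Prod.ext hp1 (funext fun v => ?_)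
  have h2 : ext p.2 v.1 = p.2 v := Subtype.val_injective.extend_apply _ _ _
  have h3 : ext p.2 (root S v.1) = 0 := by
    refine Function.extend_apply' _ _ _ ?_
    rintro ⟨w, hw⟩
    exact w.2 (by rw [hw, root_root])
  rw [← h2, ← component_root S v.1 _ hconst, h3]
  rfl

/-- The incidence matrix and its transpose have equal rank, so the 1-cocycles have dimension (edges)
− (triangles) + (dimension of the 2-cycles); `exists_cochainMap` bounds this from below. -/
theorem finite_and_finrank_le [Nonempty V] {g : V → V → G} {S : Finset (Finset V)} {τ : Finset V → G × G}
    (hA : PropertyA G) (hτ : IsLabelling g S τ)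
    (hsurj : Function.Surjective (homologyMap hτ)) :
    Module.Finite (ZMod 2) (H_ 1 G) ∧
      Module.finrank (ZMod 2) (H_ 1 G) + Fintype.card (NonRoot S) + S.card ≤
        (edges S).card + Module.finrank (ZMod 2) (cyclesOn S) := by
  obtain ⟨Θ, hΘ⟩ := exists_cochainMap hA hτ hsurj
  have hfin : Module.Finite (ZMod 2) (Module.Dual (ZMod 2) (H_ 1 G)) :=
    Module.Finite.of_injective (Θ ∘ₗ LinearMap.inl _ _ _) (hΘ.comp LinearMap.inl_injective)
  have hfin' : Module.Finite (ZMod 2) (H_ 1 G) := Module.finite_dual_iff (ZMod 2) |>.1 hfin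
  refine ⟨hfin', ?_⟩
  have h1 := LinearMap.finrank_le_finrank_of_injective hΘ
  rw [Module.finrank_prod, Subspace.dual_finrank_eq, Module.finrank_fintype_fun_eq_card] at h1
  have h2 := (incidence S).transpose.mulVecLin.finrank_range_add_finrank_ker
  have h3 := (incidence S).mulVecLin.finrank_range_add_finrank_ker
  rw [Module.finrank_fintype_fun_eq_card, Fintype.card_coe] at h2 h3
  have h4 : Module.finrank (ZMod 2) (LinearMap.range (incidence S).transpose.mulVecLin) =
      Module.finrank (ZMod 2) (LinearMap.range (incidence S).mulVecLin) :=
    Matrix.rank_transpose (incidence S)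
  rw [(cyclesEquiv S).finrank_eq]
  omega

end TriangleFamily

/-! ### Connectedness criterion, boundary matrix and top homology. -/

namespace AbstractSimplicialComplex

/-- The indicator of a clopen set, read on vertices, is constant on faces because a point is joined
to every vertex of a face containing its support. -/
theorem connectedSpace_of_locallyConstant {V : Type u} [Fintype V] [Nonempty V]
    (K : AbstractSimplicialComplex V)
    (hK : ∀ h : V → ZMod 2, (∀ s ∈ K.faces, ∀ a ∈ s, ∀ b ∈ s, h a = h b) → ∀ a b, h a = h b) :
    ConnectedSpace K.Realization := by
  classical
  have : Nonempty K.Realization := ⟨K.vertex (Classical.arbitrary V)⟩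
  have hpre : PreconnectedSpace K.Realization := by
    rw [preconnectedSpace_iff_clopen]
    intro A hA
    have key (x : K.Realization) (s : Finset V) (hs : s ∈ K.faces) (v : V) (hv : v ∈ s)
        (hx : ∀ w, x.1 w ≠ 0 → w ∈ s) : x ∈ A ↔ K.vertex v ∈ A := by
      have hj : Joined x (K.vertex v) := ⟨K.toVertex x v ⟨s, hs, hv, hx⟩⟩
      exact ⟨fun h => hA.connectedComponent_subset h (pathComponent_subset_component _ hj),
        fun h => hA.connectedComponent_subset h (pathComponent_subset_component _ hj.symm)⟩
    have hconst := hK (fun v => if K.vertex v ∈ A then 1 else 0) fun s hs a ha b hb => by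
      have := key (K.vertex a) s hs b hb fun w hw => K.eq_of_vertex_apply_ne_zero hw ▸ ha
      simp only [this]
    have hiff (a b : V) : K.vertex a ∈ A ↔ K.vertex b ∈ A := by
      have := hconst a b
      by_cases h1 : K.vertex a ∈ A <;> by_cases h2 : K.vertex b ∈ A <;> simp_all
    have hall (x : K.Realization) (a : V) : x ∈ A ↔ K.vertex a ∈ A := by
      obtain ⟨s, hs, hx⟩ := x.2.2
      obtain ⟨v, hv⟩ := K.exists_ne_zero x
      exact (key x s hs v (hx v hv) hx).trans (hiff v a)
    obtain ⟨a⟩ := ‹Nonempty V›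
    by_cases ha : K.vertex a ∈ A
    · exact Or.inr (Set.eq_univ_of_forall fun x => (hall x a).2 ha)
    · exact Or.inl (Set.eq_empty_of_forall_notMem fun x hx => ha ((hall x a).1 hx))
  exact ⟨inferInstance⟩

theorem boundary_single_apply {V : Type*} (K : AbstractSimplicialComplex V) (n : ℕ)
    (s : K.simplices (n + 1)) (e : K.simplices n) [Decidable (e.1 ⊆ s.1)] :
    K.boundary n (Finsupp.single s 1) e = if e.1 ⊆ s.1 then 1 else 0 := by
  classical
  rw [boundary, Finsupp.linearCombination_single, one_smul, Finsupp.finsetSum_apply]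
  simp only [Finsupp.single_apply, Subtype.ext_iff]
  split_ifs with h
  · obtain ⟨v, hv, hve⟩ := Finset.exists_eq_insert_iff.2
      ⟨h, show e.1.card + 1 = s.1.card by rw [e.2.2, s.2.2]⟩
    have hvs : v ∈ s.1 := hve ▸ Finset.mem_insert_self v e.1
    rw [Finset.sum_eq_single ⟨v, hvs⟩]
    · refine if_pos ?_
      ext w
      simp only [← hve, Finset.mem_erase, Finset.mem_insert]
      grind
    · rintro ⟨w, hw⟩ - hne
      rw [if_neg]
      intro he
      have hwv : w ≠ v := fun h' => hne (Subtype.ext h')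
      have : w ∈ e.1 := by
        rw [← hve] at hw
        exact (Finset.mem_insert.1 hw).resolve_left hwv
      rw [← he] at this
      simp at this
    · simp
  · refine Finset.sum_eq_zero fun v _ => if_neg fun he => h ?_
    rw [← he]
    convert Finset.erase_subset _ _

theorem finrank_homology_two {V : Type u} (K : AbstractSimplicialComplex V) (hK : K.DimLE 2) :
    Module.finrank (ZMod 2) (K.Homology 2) =
      Module.finrank (ZMod 2) (LinearMap.ker (K.boundary 1)) := by
  have : IsEmpty (K.simplices 3) := ⟨fun s => by
    have := hK s.1 s.2.1
    have := s.2.2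
    omega⟩
  have hb : K.boundaries 2 = ⊥ := by
    have h0 : K.boundary 2 = 0 := Subsingleton.elim _ _
    rw [boundaries, h0, LinearMap.range_zero]
    exact (Submodule.eq_bot_iff _).2 fun x hx => Subtype.ext hx
  exact (Submodule.quotEquivOfEqBot _ hb).finrank_eq

end AbstractSimplicialComplex

/-! ### The wedge of the components. -/

namespace TriangleFamily

variable {V : Type*} [LinearOrder V] [Fintype V]

/-- The identification of all the chosen vertices of the components to a single point. -/
def glue (S : Finset (Finset V)) (v : V) : Fin (Fintype.card (NonRoot S) + 1) :=
  Fintype.equivFinOfCardEq (α := Option (NonRoot S)) Fintype.card_option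
    (if h : root S v ≠ v then some ⟨v, h⟩ else none)

theorem glue_eq_iff {S : Finset (Finset V)} {u v : V} :
    glue S u = glue S v ↔ u = v ∨ (root S u = u ∧ root S v = v) := by
  rw [glue, glue, Equiv.apply_eq_iff_eq]
  by_cases hu : root S u = u <;> by_cases hv : root S v = v <;> simp [hu, hv]
  · rintro rfl
    exact hv hu
  · rintro rfl
    exact hu hv

theorem glue_surjective [Nonempty V] (S : Finset (Finset V)) : Function.Surjective (glue S) := by
  intro i
  obtain ⟨o, rfl⟩ := (Fintype.equivFinOfCardEq (α := Option (NonRoot S))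
    Fintype.card_option).surjective i
  rcases o with _ | ⟨v, hv⟩
  · exact ⟨root S (Classical.arbitrary V), by simp [glue, root_root]⟩
  · exact ⟨v, by simp [glue, hv]⟩

theorem eq_of_glue_eq {S : Finset (Finset V)} {u v : V} (h : (component S) u v)
    (hg : glue S u = glue S v) : u = v := by
  rcases glue_eq_iff.1 hg with h' | ⟨hu, hv⟩
  · exact h'
  · rw [← hu, ← hv, root_eq_iff]
    exact h

theorem card_image_glue {S : Finset (Finset V)} {e : Finset V} (he : ∃ t ∈ S, e ⊆ t) :
    (e.image (glue S)).card = e.card := by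
  obtain ⟨t, ht, het⟩ := he
  exact Finset.card_image_of_injOn fun u hu v hv h =>
    eq_of_glue_eq (component_of_mem ht (het hu) (het hv)) h

/-- A component has a single root, so `e` contains a non-root vertex, which is glued to nothing else
and thus lies in `e'`. Both sets are then in one component, where `glue` is injective. -/
theorem subset_of_image_glue_subset {S : Finset (Finset V)} {e e' : Finset V}
    (he : ∃ t ∈ S, e ⊆ t) (he' : ∃ t ∈ S, e' ⊆ t) (hcard : 2 ≤ e.card)
    (h : e.image (glue S) ⊆ e'.image (glue S)) : e ⊆ e' := by
  obtain ⟨t, ht, het⟩ := he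
  obtain ⟨t', ht', het'⟩ := he'
  obtain ⟨x, hx, y, hy, hxy⟩ := Finset.one_lt_card.1 hcard
  obtain ⟨u, hu, hur⟩ : ∃ u ∈ e, root S u ≠ u := by
    by_contra! hall
    refine hxy ?_
    rw [← hall x hx, ← hall y hy, root_eq_iff]
    exact component_of_mem ht (het hx) (het hy)
  have hmem {v : V} (hv : v ∈ e) : ∃ v' ∈ e', glue S v' = glue S v :=
    Finset.mem_image.1 (h (Finset.mem_image_of_mem _ hv))
  have hue' : u ∈ e' := by
    obtain ⟨u', hu', hg⟩ := hmem hu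
    rcases glue_eq_iff.1 hg with rfl | ⟨-, h'⟩
    · exact hu'
    · exact absurd h' hur
  intro v hv
  obtain ⟨v', hv', hg⟩ := hmem hv
  have h1 : (component S) v' u := component_of_mem ht' (het' hv') (het' hue')
  have h2 : (component S) u v := component_of_mem ht (het hu) (het hv)
  rw [← eq_of_glue_eq ((component S).trans' h1 h2) hg]
  exact hv'

/-- The wedge of the components of the complex generated by a family of triangles, isolated
vertices being absorbed into the wedge point. -/
def wedge (S : Finset (Finset V)) :
    AbstractSimplicialComplex (Fin (Fintype.card (NonRoot S) + 1)) where
  faces := {s | s.Nonempty ∧ ((∃ v, s = {v}) ∨ ∃ t ∈ S, s ⊆ t.image (glue S))}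
  isRelLowerSet_faces := by
    rintro s ⟨hs, hs'⟩
    refine ⟨hs, fun r hr hrn => ⟨hrn, ?_⟩⟩
    rcases hs' with ⟨v, rfl⟩ | ⟨t, ht, hst⟩
    · exact Or.inl ⟨v, (Finset.subset_singleton_iff.1 hr).resolve_left hrn.ne_empty⟩
    · exact Or.inr ⟨t, ht, hr.trans hst⟩
  singleton_mem v := ⟨Finset.singleton_nonempty v, Or.inl ⟨v, rfl⟩⟩

theorem image_glue_mem_simplices {S : Finset (Finset V)} {e : Finset V} (he : ∃ t ∈ S, e ⊆ t)
    {n : ℕ} (hn : e.card = n + 1) : e.image (glue S) ∈ (wedge S).simplices n := by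
  refine ⟨⟨?_, Or.inr ?_⟩, (card_image_glue he).trans hn⟩
  · exact (Finset.card_pos.1 (by omega)).image _
  · obtain ⟨t, ht, het⟩ := he
    exact ⟨t, ht, Finset.image_subset_image het⟩

theorem exists_of_mem_simplices {S : Finset (Finset V)} {n : ℕ} (hn : 1 ≤ n)
    {s : Finset (Fin (Fintype.card (NonRoot S) + 1))} (hs : s ∈ (wedge S).simplices n) :
    ∃ e : Finset V, (∃ t ∈ S, e ⊆ t) ∧ e.card = n + 1 ∧ e.image (glue S) = s := by
  obtain ⟨⟨-, ⟨v, rfl⟩ | ⟨t, ht, hst⟩⟩, hcard⟩ := hs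
  · rw [Finset.card_singleton] at hcard
    omega
  · obtain ⟨e, het, rfl⟩ := Finset.subset_image_iff.1 hst
    have he : ∃ t ∈ S, e ⊆ t := ⟨t, ht, by exact_mod_cast het⟩
    exact ⟨e, he, (card_image_glue he).symm.trans hcard, rfl⟩

theorem wedge_dimLE {S : Finset (Finset V)} (hS : ∀ t ∈ S, t.card = 3) : (wedge S).DimLE 2 := by
  rintro s ⟨-, ⟨v, rfl⟩ | ⟨t, ht, hst⟩⟩
  · simp
  · exact (Finset.card_le_card hst).trans (Finset.card_image_le.trans (hS t ht).le)

theorem wedge_connectedSpace [Nonempty V] (S : Finset (Finset V)) :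
    ConnectedSpace (wedge S).Realization := by
  refine (wedge S).connectedSpace_of_locallyConstant fun h hh a b => ?_
  have hloc : ∀ t ∈ S, ∀ x ∈ t, ∀ y ∈ t, h (glue S x) = h (glue S y) := fun t ht x hx y hy =>
    hh (t.image (glue S)) ⟨⟨_, Finset.mem_image_of_mem _ hx⟩, Or.inr ⟨t, ht, subset_rfl⟩⟩ _
      (Finset.mem_image_of_mem _ hx) _ (Finset.mem_image_of_mem _ hy)
  obtain ⟨u, rfl⟩ := glue_surjective S a
  obtain ⟨v, rfl⟩ := glue_surjective S b
  have hu : h (glue S (root S u)) = h (glue S u) := component_root S u (fun x => h (glue S x)) hloc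
  have hv : h (glue S (root S v)) = h (glue S v) := component_root S v (fun x => h (glue S x)) hloc
  rw [← hu, ← hv, glue_eq_iff.2 (Or.inr ⟨root_root S u, root_root S v⟩)]

/-- The edges of the wedge. -/
def edgeEquiv (S : Finset (Finset V)) : edges S ≃ (wedge S).simplices 1 :=
  Equiv.ofBijective (fun e => ⟨e.1.image (glue S),
    image_glue_mem_simplices ((mem_edges.1 e.2).imp fun _ h => ⟨h.1, h.2.1⟩)
      (mem_edges.1 e.2).choose_spec.2.2⟩) <| by
    have hsub (e : edges S) : ∃ t ∈ S, e.1 ⊆ t := (mem_edges.1 e.2).imp fun _ h => ⟨h.1, h.2.1⟩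
    have hcard (e : edges S) : e.1.card = 2 := (mem_edges.1 e.2).choose_spec.2.2
    constructor
    · intro e e' h
      have h' : e.1.image (glue S) = e'.1.image (glue S) := congrArg Subtype.val h
      exact Subtype.ext ((subset_of_image_glue_subset (hsub e) (hsub e') (hcard e).ge h'.le).antisymm
        (subset_of_image_glue_subset (hsub e') (hsub e) (hcard e').ge h'.ge))
    · rintro ⟨s, hs⟩
      obtain ⟨e, ⟨t, ht, het⟩, hc, he⟩ := exists_of_mem_simplices le_rfl hs
      exact ⟨⟨e, mem_edges.2 ⟨t, ht, het, hc⟩⟩, Subtype.ext he⟩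

/-- The triangles of the wedge. -/
def triangleEquiv {S : Finset (Finset V)} (hS : ∀ t ∈ S, t.card = 3) :
    S ≃ (wedge S).simplices 2 :=
  Equiv.ofBijective (fun t => ⟨t.1.image (glue S),
    image_glue_mem_simplices ⟨t.1, t.2, subset_rfl⟩ (hS _ t.2)⟩) <| by
    have hsub (t : S) : ∃ t' ∈ S, t.1 ⊆ t' := ⟨t.1, t.2, subset_rfl⟩
    have hcard (t : S) : 2 ≤ t.1.card := by rw [hS _ t.2]; norm_num
    constructor
    · intro e e' h
      have h' : e.1.image (glue S) = e'.1.image (glue S) := congrArg Subtype.val h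
      exact Subtype.ext ((subset_of_image_glue_subset (hsub e) (hsub e') (hcard e) h'.le).antisymm
        (subset_of_image_glue_subset (hsub e') (hsub e) (hcard e') h'.ge))
    · rintro ⟨s, hs⟩
      obtain ⟨e, ⟨t, ht, het⟩, hc, he⟩ := exists_of_mem_simplices (by norm_num) hs
      obtain rfl := Finset.eq_of_subset_of_card_le het (by rw [hc, hS t ht])
      exact ⟨⟨e, ht⟩, Subtype.ext he⟩

theorem image_subset_image_iff {S : Finset (Finset V)} (e : edges S) (t : S) :
    e.1.image (glue S) ⊆ t.1.image (glue S) ↔ e.1 ⊆ t.1 :=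
  ⟨subset_of_image_glue_subset ((mem_edges.1 e.2).imp fun _ h => ⟨h.1, h.2.1⟩)
    ⟨t.1, t.2, subset_rfl⟩ (mem_edges.1 e.2).choose_spec.2.2.ge, Finset.image_subset_image⟩

theorem numSimplices_wedge_zero (S : Finset (Finset V)) :
    (wedge S).numSimplices 0 = Fintype.card (NonRoot S) + 1 := by
  have h : (wedge S).simplices 0 = Set.range fun v => {v} := by
    ext s
    constructor
    · rintro ⟨-, hs⟩
      obtain ⟨v, rfl⟩ := Finset.card_eq_one.1 hs
      exact ⟨v, rfl⟩
    · rintro ⟨v, rfl⟩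
      exact ⟨(wedge S).singleton_mem v, Finset.card_singleton v⟩
  rw [AbstractSimplicialComplex.numSimplices, h, ← Nat.card_coe_set_eq,
    Nat.card_range_of_injective Finset.singleton_injective, Nat.card_fin]

theorem numSimplices_wedge_one (S : Finset (Finset V)) :
    (wedge S).numSimplices 1 = (edges S).card := by
  rw [AbstractSimplicialComplex.numSimplices, ← Nat.card_coe_set_eq,
    ← Nat.card_congr (edgeEquiv S), Nat.card_eq_fintype_card, Fintype.card_coe]

theorem numSimplices_wedge_two {S : Finset (Finset V)} (hS : ∀ t ∈ S, t.card = 3) :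
    (wedge S).numSimplices 2 = S.card := by
  rw [AbstractSimplicialComplex.numSimplices, ← Nat.card_coe_set_eq,
    ← Nat.card_congr (triangleEquiv hS), Nat.card_eq_fintype_card, Fintype.card_coe]

theorem _root_.AbstractSimplicialComplex.eulerChar_eq_of_dimLE_two {V : Type*} [Fintype V]
    {K : AbstractSimplicialComplex V} (hK : K.DimLE 2) :
    K.eulerChar = K.numSimplices 0 - K.numSimplices 1 + K.numSimplices 2 := by
  have h1 (n : ℕ) (hn : Fintype.card V ≤ n) : K.numSimplices n = 0 := by
    rw [AbstractSimplicialComplex.numSimplices, Set.ncard_eq_zero (Set.toFinite _)]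
    refine Set.eq_empty_of_forall_notMem fun s hs => ?_
    have := hs.2
    have := s.card_le_univ
    omega
  have h2 (n : ℕ) (hn : 3 ≤ n) : K.numSimplices n = 0 := by
    rw [AbstractSimplicialComplex.numSimplices, Set.ncard_eq_zero (Set.toFinite _)]
    refine Set.eq_empty_of_forall_notMem fun s hs => ?_
    have := hs.2
    have := hK s hs.1
    omega
  -- The range in `eulerChar` ends at the number of vertices, which may be below or above 3; the
  -- terms of difference vanish either way.
  have h3 : K.eulerChar = ∑ n ∈ Finset.range 3, (-1) ^ n * (K.numSimplices n : ℤ) := by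
    rw [AbstractSimplicialComplex.eulerChar]
    rcases le_total (Fintype.card V) 3 with h | h
    · refine Finset.sum_subset (Finset.range_subset_range.2 h) fun n _ hn => ?_
      rw [h1 n (by simpa using hn)]
      simp
    · refine (Finset.sum_subset (Finset.range_subset_range.2 h) fun n _ hn => ?_).symm
      rw [h2 n (by simpa using hn)]
      simp
  rw [h3]
  simp [Finset.sum_range_succ]
  ring

/-- Gluing preserves edges, triangles and their incidences, so the boundary matrix of the wedge is
the incidence matrix of `S`. -/
theorem finrank_homology_wedge {S : Finset (Finset V)} (hS : ∀ t ∈ S, t.card = 3) :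
    Module.finrank (ZMod 2) ((wedge S).Homology 2) =
      Module.finrank (ZMod 2) (cyclesOn S) := by
  classical
  rw [AbstractSimplicialComplex.finrank_homology_two _ (wedge_dimLE hS),
    (cyclesEquiv S).finrank_eq]
  let A : (S → ZMod 2) ≃ₗ[ZMod 2] (wedge S).Chain 2 :=
    (Finsupp.linearEquivFunOnFinite (ZMod 2) (ZMod 2) S).symm ≪≫ₗ
      Finsupp.domLCongr (triangleEquiv hS)
  let B : (edges S → ZMod 2) ≃ₗ[ZMod 2] (wedge S).Chain 1 :=
    (Finsupp.linearEquivFunOnFinite (ZMod 2) (ZMod 2) (edges S)).symm ≪≫ₗ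
      Finsupp.domLCongr (edgeEquiv S)
  have hB (y : edges S → ZMod 2) (e : edges S) : B y (edgeEquiv S e) = y e := by
    simp [B, Finsupp.domLCongr_apply]
  have hA (t : S) : A (Pi.single t 1) = Finsupp.single (triangleEquiv hS t) 1 := by
    simp [A]
  have hcomm : (wedge S).boundary 1 ∘ₗ A.toLinearMap =
      B.toLinearMap ∘ₗ (incidence S).mulVecLin := by
    refine LinearMap.pi_ext' fun t => LinearMap.ext_ring (Finsupp.ext fun e' => ?_)
    obtain ⟨e, rfl⟩ := (edgeEquiv S).surjective e'
    simp only [LinearMap.comp_apply, LinearEquiv.coe_coe, LinearMap.single_apply, hA, hB,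
      Matrix.mulVecLin_apply, Matrix.mulVec_single_one]
    rw [AbstractSimplicialComplex.boundary_single_apply]
    simp only [incidence, Matrix.col_apply, Matrix.of_apply]
    exact if_congr (image_subset_image_iff e t) rfl rfl
  have hker : LinearMap.ker (incidence S).mulVecLin =
      (LinearMap.ker ((wedge S).boundary 1)).comap A.toLinearMap := by
    rw [← LinearMap.ker_comp, hcomm, LinearEquiv.ker_comp]
  rw [hker]
  exact (A.ofSubmodule' _).finrank_eq.symm

/-- If `t` were the only triangle on an edge, the boundary of a cycle through `t` would have a
nonzero coefficient there. -/
theorem wedge_edgesInTwoTriangles {S : Finset (Finset V)} (hS : ∀ t ∈ S, t.card = 3)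
    (hfull : ∀ t ∈ S, ∃ z ∈ cyclesOn S, z t ≠ 0) : (wedge S).EdgesInTwoTriangles := by
  intro s hs
  obtain ⟨e, ⟨t, ht, het⟩, hc, rfl⟩ := exists_of_mem_simplices le_rfl hs
  obtain ⟨z, hz, hzt⟩ := hfull t ht
  obtain ⟨t', ht', het', hne⟩ : ∃ t' ∈ S, e ⊆ t' ∧ t' ≠ t := by
    by_contra! hall
    have h0 : bdry z e = 0 := congrFun hz.1 e
    rw [bdry_apply, Finset.sum_eq_single t] at h0
    · rw [if_pos (Finset.mem_powersetCard.2 ⟨het, hc⟩)] at h0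
      exact hzt h0
    · intro t' _ hne
      by_cases ht' : t' ∈ S
      · exact if_neg fun h => hne (hall t' ht' (Finset.mem_powersetCard.1 h).1)
      · rw [hz.2 t' ht', ite_self]
    · simp
  have hne' : t.image (glue S) ≠ t'.image (glue S) := fun h => by
    have := (triangleEquiv hS).injective (a₁ := ⟨t, ht⟩) (a₂ := ⟨t', ht'⟩) (Subtype.ext h)
    exact hne (congrArg Subtype.val this).symm
  refine (Set.ncard_pair hne').symm.le.trans (Set.ncard_le_ncard ?_ (Set.toFinite _))
  rintro _ (rfl | rfl)
  · exact ⟨((triangleEquiv hS) ⟨t, ht⟩).2, Finset.image_subset_image het⟩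
  · exact ⟨((triangleEquiv hS) ⟨t', ht'⟩).2, Finset.image_subset_image het'⟩

end TriangleFamily

end

/-! ### Assembly of the main theorem. -/

theorem lemma2 {V : Type*} [Fintype V] (K : AbstractSimplicialComplex V)
    {G : Type} [Group G] {T : Type*} [Group T]
    (hconn : ConnectedSpace K.Realization)
    (hdim : K.DimLE 2)
    (x₀ : K.Realization)
    (hpi : Nonempty (FundamentalGroup K.Realization x₀ ≃* Monoid.Coprod G T))
    (hA : GroupMod2.PropertyA G) :
    Module.Finite (ZMod 2) (GroupMod2.H_ 1 G) ∧ Module.Finite (ZMod 2) (GroupMod2.H_ 2 G) ∧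
    ∃ (n : ℕ) (L : AbstractSimplicialComplex (Fin n)),
      ConnectedSpace L.Realization ∧
      L.DimLE 2 ∧
      L.numSimplices 2 ≤ K.numSimplices 2 ∧
      L.eulerChar ≤ GroupMod2.truncEulerChar G ∧
      Module.finrank (ZMod 2) (L.Homology 2) = Module.finrank (ZMod 2) (GroupMod2.H_ 2 G) ∧
      L.EdgesInTwoTriangles := by
  obtain ⟨iso⟩ := hpi
  let φ : FundamentalGroup K.Realization x₀ →* G := Monoid.Coprod.fst.comp iso.toMonoidHom
  let ι : G →* FundamentalGroup K.Realization x₀ := iso.symm.toMonoidHom.comp Monoid.Coprod.inl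
  have hφι : φ.comp ι = MonoidHom.id G := by
    ext x
    simp [φ, ι]
  obtain ⟨g, hg, hlift⟩ := K.exists_isEdgeCocycle x₀ φ
  -- A lift of `φ` to `E`, restricted along `ι`, is a section of `q` because `φ ∘ ι` is the
  -- identity.
  have hsec {E : Type} [Group E] (q : E →* G) (e : V → V → E) (he : K.IsEdgeCocycle e)
      (hq : ∀ s ∈ K.faces, ∀ u ∈ s, ∀ v ∈ s, q (e u v) = g u v) :
      ∃ σ : G →* E, q.comp σ = MonoidHom.id G := by
    obtain ⟨ρ, hρ⟩ := hlift q e he hq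
    exact ⟨ρ.comp ι, by rw [← MonoidHom.comp_assoc, hρ, hφι]⟩
  have : Nonempty V := ⟨(K.exists_ne_zero x₀).choose⟩
  let _ : LinearOrder V := LinearOrder.lift' (Fintype.equivFin V) (Fintype.equivFin V).injective
  let S₀ : Finset (Finset V) := (Set.toFinite (K.simplices 2)).toFinset
  have hmem (t : Finset V) : t ∈ S₀ ↔ t ∈ K.simplices 2 := Set.Finite.mem_toFinset _
  have hτ' (t : Finset V) : ∃ p : G × G, t ∈ S₀ → ∃ u v w, u < v ∧ v < w ∧ t = {u, v, w} ∧
      p = (g u v, g v w) ∧ g u v * g v w = g u w := by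
    by_cases ht : t ∈ S₀
    · obtain ⟨u, v, w, huv, hvw, rfl⟩ := TriangleFamily.exists_lt_lt ((hmem t).1 ht).2
      exact ⟨_, fun _ => ⟨u, v, w, huv, hvw, rfl, rfl,
        hg _ ((hmem _).1 ht).1 _ (by simp) _ (by simp) _ (by simp)⟩⟩
    · exact ⟨1, fun h => absurd h ht⟩
  choose τ hτ using hτ'
  replace hτ : TriangleFamily.IsLabelling g S₀ τ := hτ
  have hsurj₀ := TriangleFamily.homologyMap_surjective hτ fun c hc b hb =>
    hc.isTwoCoboundary_of_edge hg hsec b fun s hs u hu v hv w hw huv hvw => by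
      refine hb u v w huv hvw ((hmem _).2 ⟨(K.isRelLowerSet_faces hs).2 ?_ (by simp), ?_⟩)
      · intro x hx
        simp only [Finset.mem_insert, Finset.mem_singleton] at hx
        rcases hx with rfl | rfl | rfl <;> assumption
      · exact Finset.card_eq_three.2 ⟨u, v, w, huv.ne, (huv.trans hvw).ne, hvw.ne, rfl⟩
  obtain ⟨S, hS, hbij, hfull⟩ := TriangleFamily.exists_minimal_family _ hsurj₀
  have hS3 : ∀ t ∈ S, t.card = 3 := fun t ht => ((hmem t).1 (hS ht)).2
  obtain ⟨hfin, hrank⟩ := TriangleFamily.finite_and_finrank_le hA (hτ.mono hS) hbij.2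
  let Ψ := LinearEquiv.ofBijective _ hbij
  refine ⟨hfin, Module.Finite.equiv Ψ, _, TriangleFamily.wedge S,
    TriangleFamily.wedge_connectedSpace S, TriangleFamily.wedge_dimLE hS3, ?_, ?_, ?_,
    TriangleFamily.wedge_edgesInTwoTriangles hS3 hfull⟩
  · rw [TriangleFamily.numSimplices_wedge_two hS3, AbstractSimplicialComplex.numSimplices,
      Set.ncard_eq_toFinset_card _ (Set.toFinite _)]
    exact Finset.card_le_card hS
  -- The wedge point accounts for the 1 in the vertex count and matches the dimension of `H_ 0 G`;
  -- what is left is `hrank`.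
  · rw [AbstractSimplicialComplex.eulerChar_eq_of_dimLE_two (TriangleFamily.wedge_dimLE hS3),
      TriangleFamily.numSimplices_wedge_zero, TriangleFamily.numSimplices_wedge_one,
      TriangleFamily.numSimplices_wedge_two hS3, GroupMod2.truncEulerChar,
      GroupMod2.finrank_H_zero, ← Ψ.finrank_eq]
    omega
  · rw [TriangleFamily.finrank_homology_wedge hS3, Ψ.finrank_eq]
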